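/- Let $n\ge 1$ and let $\kappa,\lambda\in\mathbb C\setminus\mathbb Z$. For $x\in\mathbb C^\times$ write $\hat x=x-x^{-1}$, and set $q=e^{\pi i\kappa}$, $p=e^{\pi i\kappa/n}$, $\eta=e^{\pi i\lambda}$. For $\tau$ in the upper half-plane $\mathbb H$ let $$\theta(z)=\vartheta_1(z,\tau)=-\sum_{m\in\mathbb Z}e^{\pi i(m+\frac12)^2\tau+2\pi i(m+\frac12)(z+\frac12)},\qquad G_\theta(z,\mu)=\frac{\theta'(0)\,\theta(z+\mu)}{\theta(z)\,\theta(\mu)},$$ $$\psi_a(z)=\sum_{m\equiv a\,(\mathrm{mod}\ n)}e^{\pi i(m-\frac{n-1}2)^2\tau/n+2\pi i(m-\frac{n-1}2)z}\quad(a=0,\dots,n-1),\qquad V=\mathrm{Span}\{\psi_0,\dots,\psi_{n-1}\},$$ and identify $V\otimes V$ with $\mathrm{Span}\{\psi_a(z_1)\psi_b(z_2)\}$. For $\alpha,\beta\in\mathbb C$ let $\mathcal R_{\alpha,\beta}(\lambda)=\mathcal F_{\alpha,\beta}(-\lambda)\,\mathcal R(\lambda)\,\mathcal F_{\alpha,\beta}(\lambda)$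 be the twisted Shibukawa–Ueno operator, acting on meromorphic functions of $(z_1,z_2)$, where $$(\mathcal R(\lambda)f)(z_1,z_2)=G_\theta(z_1-z_2,\lambda)f(z_2,z_1)-G_\theta(z_1-z_2,\kappa)f(z_1,z_2),$$ $$(\mathcal F_{\alpha,\beta}(\lambda)f)(z_1,z_2)=f(z_1+\alpha\lambda-\beta,\;z_2-\alpha\lambda+\beta).$$ If $\kappa,\lambda\notin\mathbb Z+\mathbb Z\tau$, then $\mathcal R_{1/2n,\kappa/2n}(\lambda)$ preserves $V\otimes V$, and its restriction has a unique matrix $R_B(\lambda)=(R_B(\lambda)_{ij}^{kl})$ in the basis $\psi_a\otimes\psi_b$, given by $\psi_i\otimes\psi_j\mapsto\sum_{k,l}R_B(\lambda)_{ij}^{kl}\,\psi_k\otimes\psi_l$; this is Belavin's $R$-matrix. (For given $\kappa,\lambda\notin\mathbb Z$ the condition holds whenever $\operatorname{Im}\tau$ is large enough.) Let $R_{CG}$ be the Cremmer–Gervais matrix on $\mathbb C^n\otimes\mathbb C^n$ (basis $e_0,\dots,e_{n-1}$), whose coefficients are $$(R_{CG})_{ij}^{kl}=p^{2(j-k)}\begin{cases}q,&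 i=k\ge j=l,\\ q^{-1},& i=k<j=l,\\ -\hat q,& i<k<j,\ i+j=k+l,\\ \hat q,& j\le k<i,\ i+j=k+l,\\ 0,&\text{otherwise,}\end{cases}$$ let $R_{CG}(\lambda)=\hat q\,\eta\,P-\hat\eta\,R_{CG}$ with $P(e_i\otimes e_j)=e_j\otimes e_i$, and let $R_{CG(\alpha,\beta)}(\lambda)=F_{\alpha,\beta}(-\lambda)R_{CG}(\lambda)F_{\alpha,\beta}(\lambda)$, where $F_{\alpha,\beta}(\lambda)=B(\alpha\lambda-\beta)\otimes B(\alpha\lambda-\beta)^{-1}$ and $B(\mu)e_k=e^{2\pi i\mu k}e_k$. Theorem. Let $G$ be the diagonal $n\times n$ matrix with $G_{aa}=e^{-\pi i(a-\frac{n-1}2)^2\tau/n}$, $a=0,\dots,n-1$. Then the matrix $R_B(\lambda)$ is well defined as above, and $$\lim_{\operatorname{Im}\tau\to\infty}(G\otimes G)^{-1}R_B(\lambda)(G\otimes G)=\frac{2\pi i}{\hat q\,\hat\eta}\;R_{CG(1/2n,0)}(\lambda).$$ -/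

import Mathlib

open Complex Filter Topology
open scoped Kronecker UpperHalfPlane

noncomputable section

namespace SU

/-! Elements of `V ⊗ V`, for `V` with basis `e₀, …, e_{n-1}`, are indexed by `Fin n × Fin n`, and
the coefficient `R_{ij}^{kl}` of `R (eᵢ ⊗ eⱼ) = ∑ R_{ij}^{kl} eₖ ⊗ eₗ` is the entry
`R (k, l) (i, j)` of a matrix. -/

/-- The type of matrices of endomorphisms of `V ⊗ V` with `dim V = n`. -/
abbrev Mat2 (n : ℕ) : Type := Matrix (Fin n × Fin n) (Fin n × Fin n) ℂ

/-! ### Shibukawa–Ueno operators -/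

/-- Jacobi's first theta function `ϑ₁(z, τ)`. -/
def theta1 (τ z : ℂ) : ℂ :=
  -∑' m : ℤ, cexp (Real.pi * I * ((m : ℂ) + 1 / 2) ^ 2 * τ
    + 2 * Real.pi * I * ((m : ℂ) + 1 / 2) * (z + 1 / 2))

/-- `G_θ(z, μ) = θ'(0) θ(z + μ) / (θ(z) θ(μ))`. -/
def kernelG (θ : ℂ → ℂ) (z μ : ℂ) : ℂ :=
  deriv θ 0 * θ (z + μ) / (θ z * θ μ)

/-- The Shibukawa–Ueno operator
`(𝓡^θ(lam) f)(z₁, z₂) = G_θ(z₁ - z₂, lam) f(z₂, z₁) - G_θ(z₁ - z₂, κ) f(z₁, z₂)`. -/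
def suOp (θ : ℂ → ℂ) (κ lam : ℂ) (f : ℂ → ℂ → ℂ) : ℂ → ℂ → ℂ := fun z₁ z₂ =>
  kernelG θ (z₁ - z₂) lam * f z₂ z₁ - kernelG θ (z₁ - z₂) κ * f z₁ z₂

/-- The twist `𝓕_{α,β}(lam)`, i.e. translation by `α lam - β` in the first variable and by its
negative in the second variable. -/
def opTwist (α β lam : ℂ) (f : ℂ → ℂ → ℂ) : ℂ → ℂ → ℂ := fun z₁ z₂ =>
  f (z₁ + (α * lam - β)) (z₂ - (α * lam - β))

/-- The twisted Shibukawa–Ueno operator `𝓕_{α,β}(-lam) 𝓡^θ(lam) 𝓕_{α,β}(lam)`. -/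
def twistedSU (θ : ℂ → ℂ) (κ α β lam : ℂ) (f : ℂ → ℂ → ℂ) : ℂ → ℂ → ℂ :=
  opTwist α β (-lam) (suOp θ κ lam (opTwist α β lam f))

/-- `M` is the matrix, in the basis `f_a(z₁) f_b(z₂)`, of the restriction of the operator
`𝓡^θ_{α,β}(lam)` to the span of these products; in particular that span is invariant.
The operator has coefficients that are meromorphic functions with poles where
`θ(z₁ - z₂ - 2(α lam + β)) = 0`, so the equality of meromorphic functions is equality of values
at all other points. -/
def IsRestrictionMatrix {n : ℕ} (θ : ℂ → ℂ) (κ α β lam : ℂ) (f : Fin n → ℂ → ℂ)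
    (M : Mat2 n) : Prop :=
  ∀ (i j : Fin n) (z₁ z₂ : ℂ), θ (z₁ - z₂ - 2 * (α * lam + β)) ≠ 0 →
    twistedSU θ κ α β lam (fun w₁ w₂ => f i w₁ * f j w₂) z₁ z₂ =
      ∑ k : Fin n, ∑ l : Fin n, M (k, l) (i, j) * (f k z₁ * f l z₂)

/-! ### Belavin's `R`-matrix -/

/-- The functions `ψ_a`, `a = 0, …, n-1`, a basis of the space `V^e_n` of theta functions of degree
`n`; the summation over
`m ≡ a (mod n)` is written with `m = a + n r`, `r ∈ ℤ`. -/
def psi (n : ℕ) (τ : ℂ) (a : Fin n) (z : ℂ) : ℂ :=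
  ∑' r : ℤ, cexp (Real.pi * I * (((a : ℕ) : ℂ) + n * r - ((n : ℂ) - 1) / 2) ^ 2 * τ / n
    + 2 * Real.pi * I * (((a : ℕ) : ℂ) + n * r - ((n : ℂ) - 1) / 2) * z)

/-- `M` is the matrix of the restriction of the twisted elliptic Shibukawa–Ueno operator
`𝓡^e_{1/2n, κ/2n}(lam)` to `V^e_n ⊗ V^e_n` in the basis `ψ_a ⊗ ψ_b`. -/
def IsBelavin (n : ℕ) (κ : ℂ) (τ : ℍ) (lam : ℂ) (M : Mat2 n) : Prop :=
  IsRestrictionMatrix (theta1 τ) κ (1 / (2 * n)) (κ / (2 * n)) lam (psi n τ) M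

open Classical in
/-- Belavin's `R`-matrix `R_B(lam)`: the matrix of the restriction of `𝓡^e_{1/2n, κ/2n}(lam)` to
`V^e_n ⊗ V^e_n` in the basis `ψ_a ⊗ ψ_b` (and `0` if there is no such matrix). -/
def belavinR (n : ℕ) (κ : ℂ) (τ : ℍ) (lam : ℂ) : Mat2 n :=
  if h : ∃ M : Mat2 n, IsBelavin n κ τ lam M then h.choose else 0

/-- The diagonal matrix `G` with `G_{aa} = exp(-π i (a - (n-1)/2)² τ / n)`. -/
def gaugeG (n : ℕ) (τ : ℂ) : Matrix (Fin n) (Fin n) ℂ :=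
  Matrix.diagonal fun a =>
    cexp (-(Real.pi * I * (((a : ℕ) : ℂ) - ((n : ℂ) - 1) / 2) ^ 2 * τ / n))

/-! ### Cremmer–Gervais `R`-matrices -/

/-- `x̂ = x - x⁻¹`. -/
def hat (x : ℂ) : ℂ := x - x⁻¹

/-- The permutation `P (eᵢ ⊗ eⱼ) = eⱼ ⊗ eᵢ`. -/
def permP (n : ℕ) : Mat2 n := Matrix.of fun kl ij =>
  if kl.1 = ij.2 ∧ kl.2 = ij.1 then 1 else 0

/-- The constant Cremmer–Gervais matrix with parameters `p` and `q`. -/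
def constCG (n : ℕ) (p q : ℂ) : Mat2 n := Matrix.of fun (k, l) (i, j) =>
  p ^ (2 * (((j : ℕ) : ℤ) - ((k : ℕ) : ℤ))) *
    if i = k ∧ j = l ∧ j ≤ i then q
    else if i = k ∧ j = l ∧ i < j then q⁻¹
    else if i < k ∧ k < j ∧ (i : ℕ) + (j : ℕ) = (k : ℕ) + (l : ℕ) then -hat q
    else if j ≤ k ∧ k < i ∧ (i : ℕ) + (j : ℕ) = (k : ℕ) + (l : ℕ) then hat q
    else 0

/-- The affinized Cremmer–Gervais matrix `q̂ η P - η̂ R_CG` with `q = exp(π i κ)`,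
`p = exp(π i κ / n)` (so `pⁿ = q`) and `η = exp(π i lam)`. -/
def affCG (n : ℕ) (κ lam : ℂ) : Mat2 n :=
  (hat (cexp (Real.pi * I * κ)) * cexp (Real.pi * I * lam)) • permP n
    - hat (cexp (Real.pi * I * lam)) •
      constCG n (cexp (Real.pi * I * κ / n)) (cexp (Real.pi * I * κ))

/-- The diagonal matrix `B(μ) eₖ = exp(2 π i μ k) eₖ`. -/
def twistB (n : ℕ) (μ : ℂ) : Matrix (Fin n) (Fin n) ℂ :=
  Matrix.diagonal fun k => cexp (2 * Real.pi * I * μ * ((k : ℕ) : ℂ))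

/-- The twist `F_{α,β}(lam) = B(α lam - β) ⊗ B(α lam - β)⁻¹`. -/
def twistF (n : ℕ) (α β lam : ℂ) : Mat2 n :=
  twistB n (α * lam - β) ⊗ₖ (twistB n (α * lam - β))⁻¹

/-- The twisted affinized Cremmer–Gervais matrix
`R_{CG(α,β)}(lam) = F_{α,β}(-lam) R_CG(lam) F_{α,β}(lam)`. -/
def twistedCG (n : ℕ) (κ α β lam : ℂ) : Mat2 n :=
  twistF n α β (-lam) * affCG n κ lam * twistF n α β lam

end SU

end

/-!
In coordinates the twisted operator is
`(R f)(z₁, z₂) = G(u, lam) f(z₂ + lam/n, z₁ - lam/n) - G(u, κ) f(z₁ - κ/n, z₂ + κ/n)` with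
`u = z₁ - z₂ - (lam + κ)/n`.

*The matrix exists and is unique.* The space spanned by the `ψ_a` consists of all entire functions
with the multipliers of a theta function of degree `n`, since these multipliers determine the
Fourier coefficients up to `n` of them (`IsThetaFn.exists_eq_sum_psi`). Comparison with an infinite
product shows that `ϑ₁` has exactly the points of `ℤ + ℤ τ` as zeros, all of them simple
(`theta1_eq_zero_iff`, `isSimpleZero_theta1_lattice`). The residues of the two summands of `R f`
cancel, so in each variable separately `R f` is again such a theta function
(`IsThetaFn.exists_quotient`). To combine the two variables, note that the `ψ_a` are eigenfunctions
of the translation by `1/n` with distinct eigenvalues, so the terms of a combination of the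
`ψ_a` are discrete Fourier transforms of `n` of its values (`HasPsiMultipliers.dft_eq`); this
exhibits the coefficients in the first variable as theta functions of the second
(`exists_suNum_eq_sum`). Uniqueness is the linear independence of the `ψ_a`.

*The limit.* Conjugation by `G ⊗ G` amounts to working with the scaled functions `G_{aa} ψ_a`, which
tend to the exponentials `exp(2 π i (a - (n-1)/2) z)`, while `G_θ` tends to its trigonometric
counterpart (`tendsto_psiNorm`, `tendsto_kernelG`). On exponentials the trigonometric operator is
computed by finite geometric sums, and its matrix is the multiple of the Cremmer–Gervais matrix in
question (`kernelOp_trigKernel`). The limiting exponentials have the same multipliers under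
translation by `1/n`, so the same discrete Fourier transform of finitely many values of the operator
gives the matrix entries both for finite `τ` and in the limit (`HasPsiMultipliers.dft_dft_eq`), and
pointwise convergence of the operators implies convergence of the matrices.
-/

namespace SU

/-! ### Theta functions of degree `n` -/

/-- The integral of an entire `1`-periodic function over a horizontal unit segment does not depend
on the segment. -/
lemma integral_unit_segment_of_periodic {h : ℂ → ℂ} (hd : Differentiable ℂ h)
    (hp : ∀ z, h (z + 1) = h z) (w : ℂ) :
    ∫ x in (0 : ℝ)..1, h (x + w) = ∫ x in (0 : ℝ)..1, h x := by
  have hrect := Complex.integral_boundary_rect_eq_zero_of_differentiableOn h 0 (1 + w.im * I)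
    hd.differentiableOn
  have hvert : ∀ y : ℝ, h (1 + y * I) = h (y * I) := fun y => by rw [add_comm, hp]
  have hshift : ∫ x in (0 : ℝ)..1, h (x + w) = ∫ x in (0 : ℝ)..1, h (x + w.im * I) := by
    have hper : Function.Periodic (fun x : ℝ => h (x + w.im * I)) 1 := fun x => by
      simp only
      rw [← hp (x + w.im * I)]; push_cast; ring_nf
    have := hper.intervalIntegral_add_eq w.re 0
    rw [zero_add] at this
    have hcomp := intervalIntegral.integral_comp_add_right (a := 0) (b := 1)
      (fun x : ℝ => h (x + w.im * I)) w.re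
    rw [zero_add, add_comm 1] at hcomp
    rw [← this, ← hcomp]
    refine intervalIntegral.integral_congr fun x _ => ?_
    congr 1
    push_cast
    rw [add_assoc, re_add_im]
  rw [hshift]
  simp [hvert] at hrect
  exact (sub_eq_zero.mp hrect).symm

/-- Theta functions of degree `n` with respect to the lattice `ℤ + ℤ τ`, with the multipliers of the
functions `ψ_a`; the sign for the translation by `1` is `(-1) ^ (n - 1)`. -/
structure IsThetaFn (n : ℕ) (τ : ℂ) (f : ℂ → ℂ) : Prop where
  differentiable : Differentiable ℂ f
  add_one : ∀ z, f (z + 1) = (-1) ^ (n + 1) * f z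
  add_tau : ∀ z, f (z + τ) = cexp (-(Real.pi * I * n * τ) - 2 * Real.pi * I * n * z) * f z

lemma psi_eq_jacobiTheta₂ {n : ℕ} (hn : 0 < n) (τ : ℂ) (a : Fin n) (z : ℂ) :
    psi n τ a z = cexp (Real.pi * I * (((a : ℕ) : ℂ) - ((n : ℂ) - 1) / 2) ^ 2 * τ / n +
      2 * Real.pi * I * (((a : ℕ) : ℂ) - ((n : ℂ) - 1) / 2) * z) *
      jacobiTheta₂ (n * z + (((a : ℕ) : ℂ) - ((n : ℂ) - 1) / 2) * τ) (n * τ) := by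
  have hn' : (n : ℂ) ≠ 0 := by exact_mod_cast hn.ne'
  rw [psi, jacobiTheta₂, ← tsum_mul_left]
  refine tsum_congr fun r => ?_
  rw [jacobiTheta₂_term, ← Complex.exp_add]
  congr 1
  field_simp
  ring

lemma natCast_mul_im_pos {n : ℕ} (hn : 0 < n) {τ : ℂ} (hτ : 0 < τ.im) : 0 < ((n : ℂ) * τ).im := by
  rw [← nsmul_eq_mul, Complex.im_nsmul, nsmul_eq_mul]
  have : (0 : ℝ) < n := by exact_mod_cast hn
  positivity

lemma summable_psi {n : ℕ} (hn : 0 < n) {τ : ℂ} (hτ : 0 < τ.im) (a : Fin n) (z : ℂ) :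
    Summable fun r : ℤ =>
      cexp (Real.pi * I * (((a : ℕ) : ℂ) + n * r - ((n : ℂ) - 1) / 2) ^ 2 * τ / n
    + 2 * Real.pi * I * (((a : ℕ) : ℂ) + n * r - ((n : ℂ) - 1) / 2) * z) := by
  have hn' : (n : ℂ) ≠ 0 := by exact_mod_cast hn.ne'
  have := ((summable_jacobiTheta₂_term_iff (n * z + (((a : ℕ) : ℂ) - ((n : ℂ) - 1) / 2) * τ)
    (n * τ)).mpr (natCast_mul_im_pos hn hτ)).mul_left
      (cexp (Real.pi * I * (((a : ℕ) : ℂ) - ((n : ℂ) - 1) / 2) ^ 2 * τ / n +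
      2 * Real.pi * I * (((a : ℕ) : ℂ) - ((n : ℂ) - 1) / 2) * z))
  refine this.congr fun r => ?_
  rw [jacobiTheta₂_term, ← Complex.exp_add]
  congr 1
  field_simp
  ring

lemma differentiable_jacobiTheta₂ {τ : ℂ} (hτ : 0 < τ.im) :
    Differentiable ℂ fun z => jacobiTheta₂ z τ :=
  fun z => differentiableAt_jacobiTheta₂_fst z hτ

lemma exp_half_degree (n : ℕ) : cexp (2 * Real.pi * I * (((n : ℂ) - 1) / 2)) = (-1) ^ (n + 1) := by
  rw [show 2 * Real.pi * I * (((n : ℂ) - 1) / 2) =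
      ((n + 1 : ℕ) : ℂ) * (Real.pi * I) - 2 * Real.pi * I by push_cast; ring,
    Complex.exp_sub, Complex.exp_nat_mul, Complex.exp_pi_mul_I,
    Complex.exp_two_pi_mul_I, div_one]

lemma exp_neg_half_degree (n : ℕ) :
    cexp (-(2 * Real.pi * I * (((n : ℂ) - 1) / 2))) = (-1) ^ (n + 1) := by
  rw [Complex.exp_neg, exp_half_degree, ← inv_pow, inv_neg_one]

/-- The function `ψ_a` is an eigenfunction of the translation by `1 / n`. -/
lemma psi_add_div {n : ℕ} (hn : 0 < n) (τ : ℂ) (a : Fin n) (z : ℂ) :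
    psi n τ a (z + 1 / n) =
      cexp (2 * Real.pi * I * (((a : ℕ) : ℂ) - ((n : ℂ) - 1) / 2) / n) * psi n τ a z := by
  have hn' : (n : ℂ) ≠ 0 := by exact_mod_cast hn.ne'
  rw [psi, psi, ← tsum_mul_left]
  refine tsum_congr fun r => ?_
  rw [← Complex.exp_add, Complex.exp_eq_exp_iff_exists_int]
  refine ⟨r, ?_⟩
  field_simp
  ring

lemma isThetaFn_psi {n : ℕ} (hn : 0 < n) {τ : ℂ} (hτ : 0 < τ.im) (a : Fin n) :
    IsThetaFn n τ (psi n τ a) where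
  differentiable := by
    have h1 := differentiable_jacobiTheta₂ (natCast_mul_im_pos hn hτ)
    rw [funext (psi_eq_jacobiTheta₂ hn τ a)]
    refine Differentiable.mul (by fun_prop) ?_
    exact h1.comp (f := fun z : ℂ => n * z + (((a : ℕ) : ℂ) - ((n : ℂ) - 1) / 2) * τ) (by fun_prop)
  add_one z := by
    rw [psi, psi, ← tsum_mul_left]
    refine tsum_congr fun r => ?_
    rw [← exp_neg_half_degree, ← Complex.exp_add, Complex.exp_eq_exp_iff_exists_int]
    refine ⟨a + n * r, ?_⟩
    push_cast
    ring
  add_tau z := by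
    have hn' : (n : ℂ) ≠ 0 := by exact_mod_cast hn.ne'
    rw [psi, psi, ← tsum_mul_left]
    conv_rhs => rw [← (Equiv.addRight (1 : ℤ)).tsum_eq]
    refine tsum_congr fun r => ?_
    rw [← Complex.exp_add]
    congr 1
    simp only [Equiv.coe_addRight]
    push_cast
    field_simp
    ring

/-- Two entire functions that agree on the real line are equal. -/
lemma eq_of_eq_on_real {f g : ℂ → ℂ} (hf : Differentiable ℂ f) (hg : Differentiable ℂ g)
    (h : ∀ x : ℝ, f x = g x) (z : ℂ) : f z = g z := by
  have hfr : ∃ᶠ w in 𝓝[≠] (0 : ℂ), f w = g w := by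
    have ht : Tendsto (fun x : ℝ => (x : ℂ)) (𝓝[≠] 0) (𝓝[≠] 0) := by
      refine tendsto_nhdsWithin_iff.mpr ⟨?_, ?_⟩
      · exact (Complex.continuous_ofReal.tendsto' 0 0 Complex.ofReal_zero).mono_left
          nhdsWithin_le_nhds
      · filter_upwards [self_mem_nhdsWithin] with x hx
        simpa using hx
    exact ht.frequently (Frequently.of_forall h)
  exact AnalyticOnNhd.eqOn_of_preconnected_of_frequently_eq (U := Set.univ)
    (fun w _ => hf.analyticAt w) (fun w _ => hg.analyticAt w) isPreconnected_univ
    (Set.mem_univ 0) hfr (Set.mem_univ z)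

/-- The sum over `ℤ` split into residue classes modulo `n`. -/
lemma hasSum_int_of_residues {n : ℕ} (hn : 0 < n) {φ : ℤ → ℂ}
    (h : ∀ k : Fin n, Summable fun r : ℤ => φ ((k : ℕ) + n * r)) :
    HasSum φ (∑ k : Fin n, ∑' r : ℤ, φ ((k : ℕ) + n * r)) := by
  have : NeZero n := ⟨hn.ne'⟩
  set e : Fin n × ℤ ≃ ℤ := (Equiv.prodComm _ _).trans (Int.divModEquiv n).symm with he
  have hval : ∀ p : Fin n × ℤ, e p = (p.1 : ℕ) + n * p.2 := fun p => by
    simp [he, Int.divModEquiv]; ring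
  have hs : Summable (φ ∘ e) := by
    rw [← summable_norm_iff, summable_prod_of_nonneg (fun _ => norm_nonneg _)]
    refine ⟨fun k => ?_, Summable.of_finite⟩
    simpa [hval] using (h k).norm
  have := hs.hasSum
  rw [hs.tsum_prod, tsum_fintype] at this
  simp only [Function.comp_apply, hval] at this
  rw [← e.hasSum_iff]
  exact this

/-- The functions `ψ_a` span the theta functions of degree `n`: the Fourier coefficients of such a
function satisfy a recursion of step `n`, which determines all of them from `n` of them. -/
theorem IsThetaFn.exists_eq_sum_psi {n : ℕ} (hn : 0 < n) {τ : ℂ} (hτ : 0 < τ.im) {f : ℂ → ℂ}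
    (hf : IsThetaFn n τ f) : ∃ b : Fin n → ℂ, ∀ z, f z = ∑ k, b k * psi n τ k z := by
  have hn' : (n : ℂ) ≠ 0 := by exact_mod_cast hn.ne'
  set c : ℂ := ((n : ℂ) - 1) / 2 with hc
  -- multiplication by an exponential makes `f` periodic of period one
  set g : ℂ → ℂ := fun z => cexp (2 * Real.pi * I * c * z) * f z with hg
  have hgd : Differentiable ℂ g := by
    have := hf.differentiable
    fun_prop
  have hg1 : ∀ z, g (z + 1) = g z := fun z => by
    simp only [hg]
    rw [hf.add_one, mul_add, mul_one, Complex.exp_add, exp_half_degree]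
    have : ((-1 : ℂ) ^ (n + 1)) * (-1) ^ (n + 1) = 1 := by rw [← mul_pow]; simp
    linear_combination (cexp (2 * Real.pi * I * c * z) * f z) * this
  set a : ℤ → ℂ := fun m => ∫ x in (0 : ℝ)..1, g x * cexp (-(2 * Real.pi * I * m * x)) with ha
  have ha_rec : ∀ m : ℤ, a m = cexp (-(Real.pi * I * τ * (2 * m + n - 2 * c))) * a (m + n) := by
    intro m
    have hd : Differentiable ℂ fun z => g z * cexp (-(2 * Real.pi * I * m * z)) := by fun_prop
    have hp : ∀ z, g (z + 1) * cexp (-(2 * Real.pi * I * m * (z + 1))) =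
        g z * cexp (-(2 * Real.pi * I * m * z)) := fun z => by
      rw [hg1]
      congr 1
      rw [Complex.exp_eq_exp_iff_exists_int]
      exact ⟨-m, by push_cast; ring⟩
    have := integral_unit_segment_of_periodic hd hp τ
    simp only [ha]
    rw [← this, ← intervalIntegral.integral_const_mul]
    refine intervalIntegral.integral_congr fun x _ => ?_
    simp only [hg, hf.add_tau]
    have key : cexp (2 * Real.pi * I * c * (x + τ)) *
        cexp (-(Real.pi * I * n * τ) - 2 * Real.pi * I * n * x) *
        cexp (-(2 * Real.pi * I * m * (x + τ))) =
        cexp (-(Real.pi * I * τ * (2 * m + n - 2 * c))) * cexp (2 * Real.pi * I * c * x) *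
        cexp (-(2 * Real.pi * I * ((m + n : ℤ) : ℂ) * x)) := by
      simp only [← Complex.exp_add]
      congr 1
      push_cast
      ring
    linear_combination f x * key
  -- the normalized Fourier coefficients are periodic of period `n`
  set A : ℤ → ℂ := fun m => a m * cexp (-(Real.pi * I * (m - c) ^ 2 * τ / n)) with hA
  have hAper : Function.Periodic A n := fun m => by
    simp only [hA]
    have key : cexp (-(Real.pi * I * (((m + n : ℤ) : ℂ) - c) ^ 2 * τ / n)) =
        cexp (-(Real.pi * I * τ * (2 * m + n - 2 * c))) *
          cexp (-(Real.pi * I * (m - c) ^ 2 * τ / n)) := by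
      rw [← Complex.exp_add]
      congr 1
      push_cast
      field_simp
      ring
    rw [ha_rec m]
    linear_combination a (m + n) * key
  have hcoef : ∀ (k : ℕ) (r : ℤ), a (k + n * r) =
      A k * cexp (Real.pi * I * ((k : ℂ) + n * r - c) ^ 2 * τ / n) := fun k r => by
    have : A (k + n * r) = A k := by
      rw [mul_comm]; exact hAper.int_mul r k
    rw [← this]
    simp only [hA]
    rw [mul_assoc, ← Complex.exp_add]
    push_cast
    simp
  refine ⟨fun k => A (k : ℕ), ?_⟩
  have hsum : ∀ z : ℂ, HasSum (fun m : ℤ => a m * cexp (2 * Real.pi * I * (m - c) * z))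
      (∑ k : Fin n, A (k : ℕ) * psi n τ k z) := fun z => by
    have hterm : ∀ (k : Fin n) (r : ℤ), a ((k : ℕ) + n * r) *
        cexp (2 * Real.pi * I * (((((k : ℕ) : ℤ) + n * r : ℤ) : ℂ) - c) * z) = A (k : ℕ) *
          cexp (Real.pi * I * (((k : ℕ) : ℂ) + n * r - ((n : ℂ) - 1) / 2) ^ 2 * τ / n
          + 2 * Real.pi * I * (((k : ℕ) : ℂ) + n * r - ((n : ℂ) - 1) / 2) * z) := fun k r => by
      rw [hcoef, mul_assoc, ← Complex.exp_add]
      push_cast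
      rfl
    have := hasSum_int_of_residues hn
      (φ := fun m : ℤ => a m * cexp (2 * Real.pi * I * (m - c) * z)) (fun k => by
        simp only [hterm]
        exact (summable_psi hn hτ k z).mul_left _)
    simp only [hterm, tsum_mul_left] at this
    exact this
  -- Fourier inversion on the real line
  have hper : Function.Periodic (fun x : ℝ => g x) 1 := fun x => by
    simp only
    rw [← hg1 x]; push_cast; rfl
  have hcont : Continuous fun x : ℝ => g x := hgd.continuous.comp Complex.continuous_ofReal
  let F : C(AddCircle (1 : ℝ), ℂ) := ⟨hper.lift, continuous_coinduced_dom.mpr hcont⟩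
  have hFx : ∀ x : ℝ, F (x : AddCircle (1 : ℝ)) = g x := fun x => rfl
  have hFc : ∀ m, fourierCoeff F m = a m := fun m => by
    rw [fourierCoeff_eq_intervalIntegral _ m 0]
    simp only [ha, hFx, fourier_coe_apply]
    simp only [one_div, inv_one, one_smul, zero_add, smul_eq_mul]
    refine intervalIntegral.integral_congr fun x _ => ?_
    rw [mul_comm]
    congr 2
    push_cast
    ring
  have hsummable : Summable (fourierCoeff F) := by
    have h0 := (hsum 0).summable
    simp only [mul_zero, Complex.exp_zero, mul_one] at h0
    exact h0.congr fun m => (hFc m).symm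
  refine eq_of_eq_on_real hf.differentiable ?_ ?_
  · exact Differentiable.fun_sum fun k _ => (isThetaFn_psi hn hτ k).differentiable.const_mul _
  · intro x
    have h1 := has_pointwise_sum_fourier_series_of_summable hsummable (x : AddCircle (1 : ℝ))
    simp only [hFx, hFc, fourier_coe_apply] at h1
    have h2 := h1.mul_left (cexp (-(2 * Real.pi * I * c * x)))
    have h3 : cexp (-(2 * Real.pi * I * c * x)) * g x = f x := by
      simp only [hg]
      rw [← mul_assoc, ← Complex.exp_add]
      simp
    rw [h3] at h2
    refine h2.unique ((hsum x).congr_fun fun m => ?_)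
    rw [smul_eq_mul, mul_left_comm, ← Complex.exp_add]
    congr 2
    push_cast
    ring

/-! ### The zeros of `ϑ₁` -/

/-- The infinite product `∏_{m ≥ 1} (1 - q ^ m x)`. -/
noncomputable def qProd (q x : ℂ) : ℂ := ∏' m : ℕ, (1 + -(q ^ (m + 1) * x))

lemma summable_norm_qProd_term {q : ℂ} (hq : ‖q‖ < 1) (x : ℂ) :
    Summable fun m : ℕ => ‖-(q ^ (m + 1) * x)‖ := by
  simp only [norm_neg, norm_mul, norm_pow]
  exact ((summable_nat_add_iff 1).mpr
    (summable_geometric_of_lt_one (norm_nonneg _) hq)).mul_right _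

lemma differentiable_qProd {q : ℂ} (hq : ‖q‖ < 1) : Differentiable ℂ (qProd q) := by
  intro x
  have hu : Summable fun m : ℕ => ‖q‖ ^ (m + 1) * (‖x‖ + 1) :=
    ((summable_nat_add_iff 1).mpr
      (summable_geometric_of_lt_one (norm_nonneg _) hq)).mul_right _
  have hprod := Summable.hasProdLocallyUniformlyOn_one_add (K := Metric.ball (0 : ℂ) (‖x‖ + 1))
    (f := fun (m : ℕ) (x : ℂ) => -(q ^ (m + 1) * x)) Metric.isOpen_ball hu
    (Eventually.of_forall fun m y hy => by
      rw [norm_neg, norm_mul, norm_pow]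
      have : ‖y‖ < ‖x‖ + 1 := by simpa using hy
      gcongr) (fun m => by fun_prop)
  have hd : DifferentiableOn ℂ (qProd q) (Metric.ball (0 : ℂ) (‖x‖ + 1)) :=
    hprod.differentiableOn (Eventually.of_forall fun s => by
      exact DifferentiableOn.fun_finsetProd fun _ _ => by fun_prop) Metric.isOpen_ball
  exact hd.differentiableAt (Metric.isOpen_ball.mem_nhds (by simp))

lemma qProd_eq_mul {q : ℂ} (hq : ‖q‖ < 1) (x : ℂ) : qProd q x = (1 - q * x) * qProd q (q * x) := by
  have hm : ∀ m : ℕ, (1 + -(q ^ (m + 1 + 1) * x)) = 1 + -(q ^ (m + 1) * (q * x)) := fun m => by ring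
  have h1 : Multipliable fun m : ℕ => (1 + -(q ^ (m + 1 + 1) * x)) := by
    simp only [hm]
    exact multipliable_one_add_of_summable (summable_norm_qProd_term hq (q * x))
  rw [qProd, tprod_eq_zero_mul' (f := fun m : ℕ => (1 + -(q ^ (m + 1) * x))) h1]
  simp only [hm]
  rw [qProd]
  ring

lemma exists_of_qProd_eq_zero {q : ℂ} (hq : ‖q‖ < 1) {x : ℂ} (h : qProd q x = 0) :
    ∃ m : ℕ, q ^ (m + 1) * x = 1 := by
  by_contra! hne
  exact tprod_one_add_ne_zero_of_summable
    (fun m hm => hne m (by linear_combination -hm)) (summable_norm_qProd_term hq x) h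

/-- The product `(1 - x) ∏_{m ≥ 1} (1 - q ^ m x) (1 - q ^ m x⁻¹)` with `x = exp (2 π i z)` and
`q = exp (2 π i τ)`. -/
noncomputable def thetaProd (τ z : ℂ) : ℂ :=
  (1 - cexp (2 * Real.pi * I * z)) *
    (qProd (cexp (2 * Real.pi * I * τ)) (cexp (2 * Real.pi * I * z)) *
      qProd (cexp (2 * Real.pi * I * τ)) (cexp (-(2 * Real.pi * I * z))))

lemma norm_nome_lt_one {τ : ℂ} (hτ : 0 < τ.im) : ‖cexp (2 * Real.pi * I * τ)‖ < 1 := by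
  rw [Complex.norm_exp]
  have : (2 * Real.pi * I * τ).re = -(2 * Real.pi * τ.im) := by simp
  rw [this, Real.exp_lt_one_iff]
  have := Real.pi_pos
  have : 0 < 2 * Real.pi * τ.im := by positivity
  linarith

lemma differentiable_thetaProd {τ : ℂ} (hτ : 0 < τ.im) : Differentiable ℂ (thetaProd τ) := by
  have h := differentiable_qProd (norm_nome_lt_one hτ)
  have h1 : Differentiable ℂ fun z =>
      qProd (cexp (2 * Real.pi * I * τ)) (cexp (2 * Real.pi * I * z)) :=
    h.comp (f := fun z => cexp (2 * Real.pi * I * z)) (by fun_prop)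
  have h2 : Differentiable ℂ fun z =>
      qProd (cexp (2 * Real.pi * I * τ)) (cexp (-(2 * Real.pi * I * z))) :=
    h.comp (f := fun z => cexp (-(2 * Real.pi * I * z))) (by fun_prop)
  exact Differentiable.mul (by fun_prop) (h1.mul h2)

lemma thetaProd_add_one (τ z : ℂ) : thetaProd τ (z + 1) = thetaProd τ z := by
  have h : cexp (2 * Real.pi * I * (z + 1)) = cexp (2 * Real.pi * I * z) := by
    rw [mul_add, mul_one, Complex.exp_add, Complex.exp_two_pi_mul_I, mul_one]
  simp only [thetaProd, Complex.exp_neg, h]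

lemma thetaProd_add_tau {τ : ℂ} (hτ : 0 < τ.im) (z : ℂ) :
    thetaProd τ (z + τ) = -cexp (-(2 * Real.pi * I * z)) * thetaProd τ z := by
  have hq := norm_nome_lt_one hτ
  set q := cexp (2 * Real.pi * I * τ) with hqdef
  set x := cexp (2 * Real.pi * I * z) with hx
  have hq0 : q ≠ 0 := Complex.exp_ne_zero _
  have hx0 : x ≠ 0 := Complex.exp_ne_zero _
  have h1 : cexp (2 * Real.pi * I * (z + τ)) = q * x := by
    rw [mul_add, Complex.exp_add, mul_comm]
  have e1 := qProd_eq_mul hq x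
  have e2 := qProd_eq_mul hq (q * x)⁻¹
  have h2 : q * (q * x)⁻¹ = x⁻¹ := by field_simp
  rw [h2] at e2
  simp only [thetaProd, Complex.exp_neg, ← hqdef, h1, ← hx]
  rw [e1, e2]
  field_simp
  ring

lemma eq_lattice_of_thetaProd_eq_zero {τ : ℂ} (hτ : 0 < τ.im) {z : ℂ} (h : thetaProd τ z = 0) :
    ∃ a b : ℤ, z = a + b * τ := by
  have hpi : (2 * Real.pi * I : ℂ) ≠ 0 := Complex.two_pi_I_ne_zero
  have key : ∀ w : ℂ, cexp (2 * Real.pi * I * w) = 1 → ∃ a : ℤ, w = a := fun w hw => by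
    obtain ⟨a, ha⟩ := Complex.exp_eq_one_iff.mp hw
    exact ⟨a, mul_left_cancel₀ hpi (by rw [ha]; ring)⟩
  rcases mul_eq_zero.mp h with h | h
  · obtain ⟨a, ha⟩ := key z (by linear_combination -h)
    exact ⟨a, 0, by rw [ha]; simp⟩
  rcases mul_eq_zero.mp h with h | h
  · obtain ⟨m, hm⟩ := exists_of_qProd_eq_zero (norm_nome_lt_one hτ) h
    rw [← Complex.exp_nat_mul, ← Complex.exp_add] at hm
    obtain ⟨a, ha⟩ := key ((m + 1 : ℕ) * τ + z) (by rw [← hm]; congr 1; ring)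
    exact ⟨a, -(m + 1 : ℕ), by push_cast at ha ⊢; linear_combination ha⟩
  · obtain ⟨m, hm⟩ := exists_of_qProd_eq_zero (norm_nome_lt_one hτ) h
    rw [← Complex.exp_nat_mul, ← Complex.exp_add] at hm
    obtain ⟨a, ha⟩ := key ((m + 1 : ℕ) * τ - z) (by rw [← hm]; congr 1; ring)
    exact ⟨-a, (m + 1 : ℕ), by push_cast at ha ⊢; linear_combination -ha⟩

lemma theta1_eq_jacobiTheta₂ (τ z : ℂ) : theta1 τ z =
    -(cexp (Real.pi * I * τ / 4 + Real.pi * I * (z + 1 / 2)) *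
      jacobiTheta₂ (z + 1 / 2 + τ / 2) τ) := by
  rw [theta1, jacobiTheta₂, ← tsum_mul_left]
  congr 1
  refine tsum_congr fun m => ?_
  rw [jacobiTheta₂_term, ← Complex.exp_add]
  congr 1
  ring

lemma differentiable_theta1 {τ : ℂ} (hτ : 0 < τ.im) : Differentiable ℂ (theta1 τ) := by
  rw [funext (theta1_eq_jacobiTheta₂ τ)]
  refine Differentiable.neg (Differentiable.mul (by fun_prop) ?_)
  exact (differentiable_jacobiTheta₂ hτ).comp (f := fun z : ℂ => z + 1 / 2 + τ / 2) (by fun_prop)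

lemma theta1_add_one (τ z : ℂ) : theta1 τ (z + 1) = -theta1 τ z := by
  rw [theta1_eq_jacobiTheta₂, theta1_eq_jacobiTheta₂,
    show z + 1 + 1 / 2 + τ / 2 = z + 1 / 2 + τ / 2 + 1 by ring, jacobiTheta₂_add_left,
    show Real.pi * I * τ / 4 + Real.pi * I * (z + 1 + 1 / 2) =
      Real.pi * I * τ / 4 + Real.pi * I * (z + 1 / 2) + Real.pi * I by ring,
    Complex.exp_add _ (Real.pi * I), Complex.exp_pi_mul_I]
  ring

lemma theta1_add_tau (τ z : ℂ) : theta1 τ (z + τ) =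
    -cexp (-(Real.pi * I * τ) - 2 * Real.pi * I * z) * theta1 τ z := by
  rw [theta1_eq_jacobiTheta₂, theta1_eq_jacobiTheta₂,
    show z + τ + 1 / 2 + τ / 2 = z + 1 / 2 + τ / 2 + τ by ring, jacobiTheta₂_add_left']
  have : cexp (Real.pi * I * τ / 4 + Real.pi * I * (z + τ + 1 / 2)) *
      cexp (-Real.pi * I * (τ + 2 * (z + 1 / 2 + τ / 2))) =
      -cexp (-(Real.pi * I * τ) - 2 * Real.pi * I * z) *
        cexp (Real.pi * I * τ / 4 + Real.pi * I * (z + 1 / 2)) := by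
    rw [← neg_one_mul (cexp _), ← Complex.exp_neg_pi_mul_I, ← Complex.exp_add, ← Complex.exp_add,
      ← Complex.exp_add]
    congr 1
    ring
  linear_combination -jacobiTheta₂ (z + 1 / 2 + τ / 2) τ * this

/-- Up to a factor without zeros, `ϑ₁` is the infinite product `thetaProd`: both become theta
functions of degree one after a translation, and these form a space of dimension one. -/
lemma exists_theta1_eq_thetaProd {τ : ℂ} (hτ : 0 < τ.im) : ∃ C : ℂ, C ≠ 0 ∧
    ∀ z, theta1 τ z = C * cexp (-(Real.pi * I * z)) * thetaProd τ z := by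
  have hP : IsThetaFn 1 τ fun z => thetaProd τ (z + 1 / 2 + τ / 2) := by
    refine ⟨?_, fun z => ?_, fun z => ?_⟩
    · exact (differentiable_thetaProd hτ).comp (f := fun z : ℂ => z + 1 / 2 + τ / 2) (by fun_prop)
    · rw [show z + 1 + 1 / 2 + τ / 2 = z + 1 / 2 + τ / 2 + 1 by ring, thetaProd_add_one]
      norm_num
    · rw [show z + τ + 1 / 2 + τ / 2 = z + 1 / 2 + τ / 2 + τ by ring, thetaProd_add_tau hτ]
      rw [← neg_one_mul (cexp _), ← Complex.exp_pi_mul_I, ← Complex.exp_add]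
      congr 2
      push_cast
      ring
  obtain ⟨b, hb⟩ := hP.exists_eq_sum_psi one_pos hτ
  have hb' : ∀ z, thetaProd τ (z + 1 / 2 + τ / 2) = b 0 * jacobiTheta₂ z τ := fun z => by
    rw [hb z, Fin.sum_univ_one, psi_eq_jacobiTheta₂ one_pos]
    simp
  have hb0 : b 0 ≠ 0 := by
    intro h0
    -- `τ / 2` is not a lattice point, hence not a zero of the product
    obtain ⟨a, c, hac⟩ := eq_lattice_of_thetaProd_eq_zero hτ (z := (τ / 2)) (by
      have := hb' (-(1 / 2))
      rw [h0, zero_mul] at this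
      rw [← this]; congr 1; ring)
    have him := congrArg Complex.im hac
    simp at him
    have : (c : ℝ) = 1 / 2 := by
      have : ((c : ℝ) - 1 / 2) * τ.im = 0 := by linear_combination -him
      rcases mul_eq_zero.mp this with h | h
      · linarith
      · exact absurd h hτ.ne'
    have h2 : ((2 * c : ℤ) : ℝ) = (1 : ℤ) := by push_cast; rw [this]; norm_num
    have := Int.cast_injective h2
    omega
  refine ⟨cexp (Real.pi * I * τ / 4 + Real.pi * I / 2) / b 0,
    div_ne_zero (Complex.exp_ne_zero _) hb0, fun z => ?_⟩
  have h1 := hb' (z + 1 / 2 + τ / 2)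
  rw [show z + 1 / 2 + τ / 2 + 1 / 2 + τ / 2 = z + 1 + τ by ring, thetaProd_add_tau hτ,
    thetaProd_add_one] at h1
  have h2 : cexp (Real.pi * I * τ / 4 + Real.pi * I * (z + 1 / 2)) *
      cexp (-(2 * Real.pi * I * (z + 1))) =
      cexp (Real.pi * I * τ / 4 + Real.pi * I / 2) * cexp (-(Real.pi * I * z)) := by
    rw [← Complex.exp_add, ← Complex.exp_add, Complex.exp_eq_exp_iff_exists_int]
    exact ⟨-1, by push_cast; ring⟩
  rw [theta1_eq_jacobiTheta₂, div_mul_eq_mul_div, div_mul_eq_mul_div, eq_div_iff hb0, ← h2]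
  linear_combination cexp (Real.pi * I * τ / 4 + Real.pi * I * (z + 1 / 2)) * h1

/-- A property invariant under translation by `1` and by `τ` is invariant under the lattice. -/
lemma lattice_invariant {p : ℂ → Prop} {τ : ℂ} (h1 : ∀ z, p (z + 1) ↔ p z)
    (hτ : ∀ z, p (z + τ) ↔ p z) (z : ℂ) (a b : ℤ) : p (z + (a + b * τ)) ↔ p z := by
  have ha : ∀ (a : ℤ) z, p (z + a) ↔ p z := fun a => by
    induction a using Int.induction_on with
    | zero => simp
    | succ i ih => intro z; rw [← ih z, ← h1 (z + (i : ℤ))]; push_cast; rw [add_assoc]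
    | pred i ih => intro z; rw [← ih z, ← h1 (z + _)]; push_cast; ring_nf
  have hb : ∀ (b : ℤ) z, p (z + b * τ) ↔ p z := fun b => by
    induction b using Int.induction_on with
    | zero => simp
    | succ i ih =>
      intro z
      rw [← ih z, ← hτ (z + (i : ℤ) * τ)]
      push_cast
      rw [add_mul, one_mul, add_assoc]
    | pred i ih => intro z; rw [← ih z, ← hτ (z + _)]; push_cast; ring_nf
  rw [← add_assoc, hb, ha]

/-- The point `z` is a simple zero of `f`. -/
def IsSimpleZero (f : ℂ → ℂ) (z : ℂ) : Prop := f z = 0 ∧ deriv f z ≠ 0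

/-- A quasi-period of an entire function preserves its simple zeros. -/
lemma isSimpleZero_add_iff {f e : ℂ → ℂ} {w : ℂ} (hf : Differentiable ℂ f)
    (he : Differentiable ℂ e) (he0 : ∀ z, e z ≠ 0) (h : ∀ z, f (z + w) = e z * f z) (z : ℂ) :
    IsSimpleZero f (z + w) ↔ IsSimpleZero f z := by
  have hd : f z = 0 → deriv f (z + w) = e z * deriv f z := fun h0 => by
    rw [← deriv_comp_add_const, funext h, deriv_fun_mul he.differentiableAt hf.differentiableAt, h0]
    ring
  have hz : f (z + w) = 0 ↔ f z = 0 := by rw [h]; simp [he0]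
  constructor
  · rintro ⟨h1, h2⟩
    have h3 := hz.mp h1
    exact ⟨h3, fun h4 => h2 (by rw [hd h3, h4, mul_zero])⟩
  · rintro ⟨h1, h2⟩
    exact ⟨hz.mpr h1, by rw [hd h1]; exact mul_ne_zero (he0 z) h2⟩

lemma theta1_zero {τ : ℂ} (hτ : 0 < τ.im) : theta1 τ 0 = 0 := by
  obtain ⟨C, -, hC⟩ := exists_theta1_eq_thetaProd hτ
  simp [hC, thetaProd]

lemma qProd_nome_one_ne_zero {τ : ℂ} (hτ : 0 < τ.im) :
    qProd (cexp (2 * Real.pi * I * τ)) 1 ≠ 0 := by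
  intro h
  obtain ⟨m, hm⟩ := exists_of_qProd_eq_zero (norm_nome_lt_one hτ) h
  have h1 := norm_nome_lt_one hτ
  rw [mul_one] at hm
  have := congrArg norm hm
  rw [norm_pow, norm_one] at this
  exact (pow_lt_one₀ (norm_nonneg _) h1 (Nat.succ_ne_zero m)).ne this

lemma deriv_theta1_zero_ne_zero {τ : ℂ} (hτ : 0 < τ.im) : deriv (theta1 τ) 0 ≠ 0 := by
  obtain ⟨C, hC0, hC⟩ := exists_theta1_eq_thetaProd hτ
  have h := differentiable_qProd (norm_nome_lt_one hτ)
  set k : ℂ → ℂ := fun z => C * cexp (-(Real.pi * I * z)) *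
    (qProd (cexp (2 * Real.pi * I * τ)) (cexp (2 * Real.pi * I * z)) *
      qProd (cexp (2 * Real.pi * I * τ)) (cexp (-(2 * Real.pi * I * z)))) with hk
  have hkd : Differentiable ℂ k := by
    have h1 : Differentiable ℂ fun z =>
        qProd (cexp (2 * Real.pi * I * τ)) (cexp (2 * Real.pi * I * z)) :=
      h.comp (f := fun z => cexp (2 * Real.pi * I * z)) (by fun_prop)
    have h2 : Differentiable ℂ fun z =>
        qProd (cexp (2 * Real.pi * I * τ)) (cexp (-(2 * Real.pi * I * z))) :=
      h.comp (f := fun z => cexp (-(2 * Real.pi * I * z))) (by fun_prop)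
    exact Differentiable.mul (by fun_prop) (h1.mul h2)
  have hθ : theta1 τ = fun z => (1 - cexp (2 * Real.pi * I * z)) * k z := by
    funext z
    rw [hC, thetaProd, hk]
    ring
  have hd : HasDerivAt (fun z : ℂ => 1 - cexp (2 * Real.pi * I * z)) (-(2 * Real.pi * I)) 0 := by
    have := (((hasDerivAt_id (0 : ℂ)).const_mul (2 * Real.pi * I)).cexp).const_sub 1
    simpa using this
  rw [hθ, (hd.fun_mul (hkd 0).hasDerivAt).deriv]
  have hA := qProd_nome_one_ne_zero hτ
  simp [hk, hC0, hA, Real.pi_ne_zero]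

lemma isSimpleZero_theta1_lattice {τ : ℂ} (hτ : 0 < τ.im) (a b : ℤ) :
    IsSimpleZero (theta1 τ) (a + b * τ) := by
  have hd := differentiable_theta1 hτ
  have := (lattice_invariant (p := IsSimpleZero (theta1 τ)) (τ := τ)
    (isSimpleZero_add_iff hd (e := fun _ => -1) (by fun_prop) (by simp)
      (fun z => by rw [theta1_add_one]; ring))
    (isSimpleZero_add_iff hd (e := fun z => -cexp (-(Real.pi * I * τ) - 2 * Real.pi * I * z))
      (by fun_prop) (fun z => neg_ne_zero.mpr (Complex.exp_ne_zero _)) (theta1_add_tau τ))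
    0 a b).mpr ⟨theta1_zero hτ, deriv_theta1_zero_ne_zero hτ⟩
  rwa [zero_add] at this

/-- The zeros of `ϑ₁` are the points of the lattice `ℤ + ℤ τ`. -/
lemma theta1_eq_zero_iff {τ : ℂ} (hτ : 0 < τ.im) {z : ℂ} :
    theta1 τ z = 0 ↔ ∃ a b : ℤ, z = a + b * τ := by
  constructor
  · intro h
    obtain ⟨C, hC0, hC⟩ := exists_theta1_eq_thetaProd hτ
    rw [hC] at h
    refine eq_lattice_of_thetaProd_eq_zero hτ ?_
    simpa [hC0, Complex.exp_ne_zero] using h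
  · rintro ⟨a, b, rfl⟩
    exact (isSimpleZero_theta1_lattice hτ a b).1

/-! ### Entire functions -/

/-- The ring of entire functions has no zero divisors. -/
lemma eq_zero_of_mul_eq_zero_of_ne {f g : ℂ → ℂ} (hf : Differentiable ℂ f) (hg : Differentiable ℂ g)
    (h : ∀ z, f z * g z = 0) {w : ℂ} (hw : f w ≠ 0) (z : ℂ) : g z = 0 := by
  rcases AnalyticOnNhd.eq_zero_or_eq_zero_of_mul_eq_zero (U := Set.univ)
    (fun z _ => hf.analyticAt z) (fun z _ => hg.analyticAt z) (fun z _ => h z)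
    isPreconnected_univ with h0 | h0
  · exact absurd (h0 w (Set.mem_univ w)) hw
  · exact h0 z (Set.mem_univ z)

lemma exists_prod_ne_zero {ι : Type*} (s : Finset ι) {f : ι → ℂ → ℂ}
    (hf : ∀ i, Differentiable ℂ (f i)) (h : ∀ i, ∃ w, f i w ≠ 0) : ∃ w, ∏ i ∈ s, f i w ≠ 0 := by
  classical
  induction s using Finset.induction_on with
  | empty => exact ⟨0, by simp⟩
  | insert a s ha ih =>
    obtain ⟨w, hw⟩ := ih
    by_contra! h0
    obtain ⟨v, hv⟩ := h a
    refine hw (eq_zero_of_mul_eq_zero_of_ne (hf a)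
      (Differentiable.fun_finsetProd fun i _ => hf i) (fun z => ?_) hv w)
    rw [← h0 z, Finset.prod_insert ha]

/-- An entire function is divisible by an entire function with simple zeros if it vanishes at all of
them. -/
lemma exists_entire_quotient {N θ : ℂ → ℂ} (hN : Differentiable ℂ N) (hθ : Differentiable ℂ θ)
    (h : ∀ z, θ z = 0 → N z = 0 ∧ deriv θ z ≠ 0) :
    ∃ E : ℂ → ℂ, Differentiable ℂ E ∧ ∀ z, N z = θ z * E z := by
  classical
  refine ⟨fun z => if θ z = 0 then deriv N z / deriv θ z else N z / θ z, fun z₀ => ?_, fun z => ?_⟩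
  · by_cases h0 : θ z₀ = 0
    · obtain ⟨hN0, hd0⟩ := h z₀ h0
      have hds : ∀ {f : ℂ → ℂ}, Differentiable ℂ f → DifferentiableAt ℂ (dslope f z₀) z₀ :=
        fun hf => ((Complex.differentiableOn_dslope Filter.univ_mem).mpr
          hf.differentiableOn).differentiableAt Filter.univ_mem
      have hne : ∀ᶠ z in 𝓝 z₀, dslope θ z₀ z ≠ 0 :=
        (hds hθ).continuousAt.eventually_ne (by rwa [dslope_same])
      refine ((hds hN).div (hds hθ) (by rwa [dslope_same])).congr_of_eventuallyEq ?_
      filter_upwards [hne] with z hz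
      rcases eq_or_ne z z₀ with rfl | hzz
      · simp [h0]
      · have hsub : z - z₀ ≠ 0 := sub_ne_zero.mpr hzz
        rw [dslope_of_ne _ hzz, slope_def_field, h0, sub_zero] at hz
        have hz' : θ z ≠ 0 := fun h => hz (by rw [h, zero_div])
        simp only [hz', if_false, Pi.div_apply]
        rw [dslope_of_ne _ hzz, dslope_of_ne _ hzz, slope_def_field, slope_def_field, h0, hN0]
        field_simp
        ring
    · have hne : ∀ᶠ z in 𝓝 z₀, θ z ≠ 0 := hθ.continuous.continuousAt.eventually_ne h0
      refine ((hN z₀).div (hθ z₀) h0).congr_of_eventuallyEq ?_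
      filter_upwards [hne] with z hz
      simp [hz]
  · by_cases h0 : θ z = 0
    · rw [h0, (h z h0).1, zero_mul]
    · simp only [h0, if_false]
      field_simp

/-! ### The discrete Fourier transform -/

/-- The functions `φ_a` have the same multipliers under translation by `1 / n` as the `ψ_a`. -/
def HasPsiMultipliers (n : ℕ) (φ : Fin n → ℂ → ℂ) : Prop := ∀ a z, φ a (z + 1 / n) =
  cexp (2 * Real.pi * I * (((a : ℕ) : ℂ) - ((n : ℂ) - 1) / 2) / n) * φ a z

/-- The projection onto the functions with the multiplier of `ψ_k` under translation by `1 / n`. -/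
noncomputable def dft (n : ℕ) (k : Fin n) (H : ℂ → ℂ) (z : ℂ) : ℂ :=
  (∑ s ∈ Finset.range n,
    cexp (-(2 * Real.pi * I * (((k : ℕ) : ℂ) - ((n : ℂ) - 1) / 2) * s / n)) * H (z + s / n)) / n

lemma sum_exp_range {n : ℕ} (a k : Fin n) : ∑ s ∈ Finset.range n,
    cexp (2 * Real.pi * I * (((a : ℕ) : ℂ) - ((k : ℕ) : ℂ)) * s / n) =
      if a = k then (n : ℂ) else 0 := by
  have hn : (n : ℂ) ≠ 0 := by
    have := a.pos
    exact_mod_cast this.ne'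
  split_ifs with h
  · simp [h]
  · set ζ := cexp (2 * Real.pi * I * (((a : ℕ) : ℂ) - ((k : ℕ) : ℂ)) / n) with hζ
    have hζn : ζ ^ n = 1 := by
      rw [hζ, ← Complex.exp_nat_mul, Complex.exp_eq_one_iff]
      exact ⟨(a : ℕ) - (k : ℕ), by push_cast; field_simp⟩
    have hζ1 : ζ ≠ 1 := by
      intro h1
      obtain ⟨m, hm⟩ := Complex.exp_eq_one_iff.mp h1
      have h2 : (((a : ℕ) : ℂ) - ((k : ℕ) : ℂ)) = m * n := by
        refine mul_left_cancel₀ Complex.two_pi_I_ne_zero ?_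
        rw [div_eq_iff hn] at hm
        linear_combination hm
      have h3 : ((a : ℕ) : ℤ) - ((k : ℕ) : ℤ) = m * n := by exact_mod_cast h2
      have ha := a.isLt
      have hk := k.isLt
      have hm0 : m = 0 := by
        by_contra hm0
        have h4 : (n : ℤ) ≤ |m * n| := by
          rw [abs_mul, Nat.abs_cast]
          nlinarith [Int.one_le_abs hm0]
        rw [← h3] at h4
        have h5 : |((a : ℕ) : ℤ) - ((k : ℕ) : ℤ)| < n := abs_lt.mpr ⟨by omega, by omega⟩
        omega
      rw [hm0, zero_mul] at h3
      exact h (Fin.ext (by omega))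
    have : ∀ s ∈ Finset.range n,
        cexp (2 * Real.pi * I * (((a : ℕ) : ℂ) - ((k : ℕ) : ℂ)) * s / n) = ζ ^ s := fun s _ => by
      rw [hζ, ← Complex.exp_nat_mul]
      congr 1
      ring
    rw [Finset.sum_congr rfl this, geom_sum_eq hζ1, hζn, sub_self, zero_div]

lemma HasPsiMultipliers.add_nat_div {n : ℕ} {φ : Fin n → ℂ → ℂ} (hφ : HasPsiMultipliers n φ)
    (a : Fin n) (z : ℂ) (s : ℕ) : φ a (z + s / n) =
      cexp (2 * Real.pi * I * (((a : ℕ) : ℂ) - ((n : ℂ) - 1) / 2) * s / n) * φ a z := by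
  induction s with
  | zero => simp
  | succ s ih =>
    rw [show z + ((s + 1 : ℕ) : ℂ) / n = z + s / n + 1 / n by push_cast; ring, hφ, ih, ← mul_assoc,
      ← Complex.exp_add]
    congr 2
    push_cast
    ring

lemma HasPsiMultipliers.dft_eq {n : ℕ} {φ : Fin n → ℂ → ℂ} (hφ : HasPsiMultipliers n φ)
    {H : ℂ → ℂ} {b : Fin n → ℂ} {z : ℂ}
    (hH : ∀ s < n, H (z + s / n) = ∑ a, b a * φ a (z + s / n)) (k : Fin n) :
    dft n k H z = b k * φ k z := by
  have hn : (n : ℂ) ≠ 0 := by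
    have := k.pos
    exact_mod_cast this.ne'
  have h1 : ∀ s ∈ Finset.range n,
      cexp (-(2 * Real.pi * I * (((k : ℕ) : ℂ) - ((n : ℂ) - 1) / 2) * s / n)) * H (z + s / n) =
      ∑ a, b a * φ a z *
        cexp (2 * Real.pi * I * (((a : ℕ) : ℂ) - ((k : ℕ) : ℂ)) * s / n) := fun s hs => by
    rw [hH s (Finset.mem_range.mp hs), Finset.mul_sum]
    refine Finset.sum_congr rfl fun a _ => ?_
    rw [hφ.add_nat_div]
    have : cexp (2 * Real.pi * I * (((a : ℕ) : ℂ) - ((k : ℕ) : ℂ)) * s / n) =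
        cexp (-(2 * Real.pi * I * (((k : ℕ) : ℂ) - ((n : ℂ) - 1) / 2) * s / n)) *
        cexp (2 * Real.pi * I * (((a : ℕ) : ℂ) - ((n : ℂ) - 1) / 2) * s / n) := by
      rw [← Complex.exp_add]
      congr 1
      ring
    rw [this]
    ring
  rw [dft, Finset.sum_congr rfl h1, Finset.sum_comm]
  simp_rw [← Finset.mul_sum, sum_exp_range]
  simp [hn]

lemma dft_sum_mul {n m : ℕ} (k : Fin n) (d : ℂ → Fin m → ℂ) (c : Fin m → ℂ) (z : ℂ) :
    dft n k (fun w => ∑ l, d w l * c l) z = ∑ l, dft n k (fun w => d w l) z * c l := by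
  simp only [dft, Finset.mul_sum, Finset.sum_div, Finset.sum_mul]
  rw [Finset.sum_comm]
  refine Finset.sum_congr rfl fun l _ => Finset.sum_congr rfl fun s _ => by ring

/-! ### The restriction of the Shibukawa–Ueno operator -/

lemma exists_theta1_ne_zero {τ : ℂ} (hτ : 0 < τ.im) : ∃ w, theta1 τ w ≠ 0 := by
  by_contra! h
  refine deriv_theta1_zero_ne_zero hτ ?_
  rw [funext h]
  simp

lemma exists_psi_ne_zero {n : ℕ} (hn : 0 < n) {τ : ℂ} (hτ : 0 < τ.im) (a : Fin n) :
    ∃ w, psi n τ a w ≠ 0 := by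
  have hn' : (n : ℂ) ≠ 0 := by exact_mod_cast hn.ne'
  obtain ⟨w, hw⟩ := exists_theta1_ne_zero (natCast_mul_im_pos hn hτ)
  rw [theta1_eq_jacobiTheta₂] at hw
  refine ⟨(w + 1 / 2 + n * τ / 2 - (((a : ℕ) : ℂ) - ((n : ℂ) - 1) / 2) * τ) / n, ?_⟩
  rw [psi_eq_jacobiTheta₂ hn, mul_div_cancel₀ _ hn', sub_add_cancel]
  exact mul_ne_zero (Complex.exp_ne_zero _) (right_ne_zero_of_mul (neg_ne_zero.mp hw))

lemma hasPsiMultipliers_psi {n : ℕ} (hn : 0 < n) (τ : ℂ) : HasPsiMultipliers n (psi n τ) :=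
  psi_add_div hn τ

lemma eq_zero_of_sum_psi {n : ℕ} (hn : 0 < n) {τ : ℂ} (hτ : 0 < τ.im) {b : Fin n → ℂ}
    (h : ∀ z, ∑ a, b a * psi n τ a z = 0) (k : Fin n) : b k = 0 := by
  obtain ⟨w, hw⟩ := exists_psi_ne_zero hn hτ k
  have := (hasPsiMultipliers_psi hn τ).dft_eq (H := fun _ => 0) (b := b) (z := w)
    (fun s _ => (h _).symm) k
  have h0 : dft n k (fun _ => 0) w = 0 := by simp [dft]
  rw [h0] at this
  exact (mul_eq_zero.mp this.symm).resolve_right hw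

lemma theta1_neg (τ z : ℂ) : theta1 τ (-z) = -theta1 τ z := by
  rw [theta1, theta1, neg_neg, ← tsum_neg]
  conv_rhs => rw [← ((Equiv.neg ℤ).trans (Equiv.addRight (-1 : ℤ))).tsum_eq]
  refine tsum_congr fun m => ?_
  rw [← neg_one_mul (cexp _), ← Complex.exp_pi_mul_I, ← Complex.exp_add,
    Complex.exp_eq_exp_iff_exists_int]
  refine ⟨m + 1, ?_⟩
  simp only [Equiv.trans_apply, Equiv.neg_apply, Equiv.coe_addRight]
  push_cast
  ring

/-- A combination of two products of degree `n + 1` that vanishes at `d` is `ϑ₁(z - d)` times a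
theta function of degree `n`. -/
lemma IsThetaFn.exists_quotient {n : ℕ} (hn : 0 < n) {τ : ℂ} (hτ : 0 < τ.im) {f g : ℂ → ℂ}
    (hf : IsThetaFn n τ f) (hg : IsThetaFn n τ g) {d μ ν A B : ℂ}
    (hd : A * (theta1 τ μ * g (d - μ / n)) = B * (theta1 τ ν * f (d - ν / n))) :
    ∃ b : Fin n → ℂ, ∀ z, A * (theta1 τ (z - d + μ) * g (z - μ / n)) -
      B * (theta1 τ (z - d + ν) * f (z - ν / n)) = theta1 τ (z - d) * ∑ k, b k * psi n τ k z := by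
  have hn' : (n : ℂ) ≠ 0 := by exact_mod_cast hn.ne'
  have hθ := differentiable_theta1 hτ
  set N : ℂ → ℂ := fun z => A * (theta1 τ (z - d + μ) * g (z - μ / n)) -
      B * (theta1 τ (z - d + ν) * f (z - ν / n)) with hN
  have hNd : Differentiable ℂ N := by
    have h1 := hf.differentiable
    have h2 := hg.differentiable
    fun_prop
  have hN1 : ∀ z, N (z + 1) = -((-1) ^ (n + 1)) * N z := fun z => by
    simp only [hN]
    rw [show z + 1 - d + μ = z - d + μ + 1 by ring, show z + 1 - d + ν = z - d + ν + 1 by ring,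
      show z + 1 - μ / n = z - μ / n + 1 by ring, show z + 1 - ν / n = z - ν / n + 1 by ring,
      theta1_add_one, theta1_add_one, hf.add_one, hg.add_one]
    ring
  -- the shift by `μ / n` in a function of degree `n` compensates the shift by `μ` in `ϑ₁`
  have hfac : ∀ z μ : ℂ, cexp (-(Real.pi * I * τ) - 2 * Real.pi * I * (z - d + μ)) *
      cexp (-(Real.pi * I * n * τ) - 2 * Real.pi * I * n * (z - μ / n)) =
      cexp (-(Real.pi * I * τ) - 2 * Real.pi * I * (z - d)) *
      cexp (-(Real.pi * I * n * τ) - 2 * Real.pi * I * n * z) := fun z μ => by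
    rw [← Complex.exp_add, ← Complex.exp_add]
    congr 1
    field_simp
    ring
  have hNτ : ∀ z, N (z + τ) = -(cexp (-(Real.pi * I * τ) - 2 * Real.pi * I * (z - d)) *
      cexp (-(Real.pi * I * n * τ) - 2 * Real.pi * I * n * z)) * N z := fun z => by
    simp only [hN]
    rw [show z + τ - d + μ = z - d + μ + τ by ring, show z + τ - d + ν = z - d + ν + τ by ring,
      show z + τ - μ / n = z - μ / n + τ by ring, show z + τ - ν / n = z - ν / n + τ by ring,
      theta1_add_tau, theta1_add_tau, hf.add_tau, hg.add_tau]
    linear_combination -A * theta1 τ (z - d + μ) * g (z - μ / n) * hfac z μ +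
      B * theta1 τ (z - d + ν) * f (z - ν / n) * hfac z ν
  have hN0 : N d = 0 := by
    simp only [hN, sub_self, zero_add]
    rw [hd, sub_self]
  have hzero : ∀ z, theta1 τ (z - d) = 0 →
      N z = 0 ∧ deriv (fun z => theta1 τ (z - d)) z ≠ 0 := fun z hz => by
    obtain ⟨a, b, hab⟩ := (theta1_eq_zero_iff hτ).mp hz
    have hz' : z = d + (a + b * τ) := by rw [← hab]; ring
    constructor
    · rw [hz']
      refine (lattice_invariant (p := fun z => N z = 0) (fun z => ?_) (fun z => ?_) d a b).mpr hN0
      · rw [hN1]; simp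
      · rw [hNτ]; simp [Complex.exp_ne_zero]
    · rw [deriv_comp_sub_const, hab]
      exact (isSimpleZero_theta1_lattice hτ a b).2
  have hθd : Differentiable ℂ fun z => theta1 τ (z - d) := by fun_prop
  -- the quotient inherits its multipliers by cancelling `ϑ₁(z - d)`
  obtain ⟨E, hE, hNE⟩ := exists_entire_quotient hNd hθd hzero
  obtain ⟨w, hw⟩ := exists_theta1_ne_zero hτ
  have hw' : theta1 τ (w + d - d) ≠ 0 := by rwa [add_sub_cancel_right]
  have hEθ : IsThetaFn n τ E := by
    refine ⟨hE, fun z => ?_, fun z => ?_⟩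
    · refine sub_eq_zero.mp (eq_zero_of_mul_eq_zero_of_ne hθd
        (g := fun z => E (z + 1) - (-1) ^ (n + 1) * E z) (by fun_prop) (fun z => ?_) hw' z)
      have h1 := hN1 z
      rw [hNE, hNE, show z + 1 - d = z - d + 1 by ring, theta1_add_one] at h1
      linear_combination -h1
    · refine sub_eq_zero.mp (eq_zero_of_mul_eq_zero_of_ne hθd
        (g := fun z => E (z + τ) -
          cexp (-(Real.pi * I * n * τ) - 2 * Real.pi * I * n * z) * E z) (by fun_prop)
        (fun z => ?_) hw' z)
      have h1 := hNτ z
      rw [hNE, hNE, show z + τ - d = z - d + τ by ring, theta1_add_tau] at h1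
      refine mul_left_cancel₀ (Complex.exp_ne_zero
        (-(Real.pi * I * τ) - 2 * Real.pi * I * (z - d))) ?_
      linear_combination -h1
  obtain ⟨b, hb⟩ := hEθ.exists_eq_sum_psi hn hτ
  refine ⟨b, fun z => ?_⟩
  rw [← hb]
  exact hNE z

/-- The numerator of the twisted Shibukawa–Ueno operator applied to `f(z₁) g(z₂)`, over the common
denominator `ϑ₁(κ) ϑ₁(lam) ϑ₁(z₁ - z₂ - (lam + κ) / n)`, up to the factor `ϑ₁'(0)`. -/
noncomputable def suNum (n : ℕ) (τ κ lam : ℂ) (f g : ℂ → ℂ) (z₁ z₂ : ℂ) : ℂ :=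
  theta1 τ κ * (theta1 τ (z₁ - z₂ - (lam + κ) / n + lam) * (f (z₂ + lam / n) * g (z₁ - lam / n))) -
  theta1 τ lam * (theta1 τ (z₁ - z₂ - (lam + κ) / n + κ) * (f (z₁ - κ / n) * g (z₂ + κ / n)))

lemma twistedSU_apply {n : ℕ} (hn : 0 < n) (θ : ℂ → ℂ) (κ lam : ℂ) (f g : ℂ → ℂ) (z₁ z₂ : ℂ) :
    twistedSU θ κ (1 / (2 * n)) (κ / (2 * n)) lam (fun w₁ w₂ => f w₁ * g w₂) z₁ z₂ =
      kernelG θ (z₁ - z₂ - (lam + κ) / n) lam * (f (z₂ + lam / n) * g (z₁ - lam / n)) -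
      kernelG θ (z₁ - z₂ - (lam + κ) / n) κ * (f (z₁ - κ / n) * g (z₂ + κ / n)) := by
  have hn' : (n : ℂ) ≠ 0 := by exact_mod_cast hn.ne'
  simp only [twistedSU, opTwist, suOp]
  congr 1 <;> congr 1
  · congr 1; field_simp; ring
  · congr 2 <;> · field_simp; ring
  · congr 1; field_simp; ring
  · congr 2 <;> · field_simp; ring

lemma two_mul_twist_params {n : ℕ} (hn : 0 < n) (κ lam : ℂ) :
    2 * (1 / (2 * (n : ℂ)) * lam + κ / (2 * n)) = (lam + κ) / n := by
  have hn' : (n : ℂ) ≠ 0 := by exact_mod_cast hn.ne'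
  field_simp

/-- The operator preserves `V ⊗ V`, written without denominators. In each variable separately the
image is a theta function of degree `n`; its coefficients in the first variable are recovered from
finitely many values, hence are theta functions in the second variable. -/
lemma exists_suNum_eq_sum {n : ℕ} (hn : 0 < n) {τ : ℂ} (hτ : 0 < τ.im) (κ lam : ℂ) {f g : ℂ → ℂ}
    (hf : IsThetaFn n τ f) (hg : IsThetaFn n τ g) : ∃ M : Fin n → Fin n → ℂ, ∀ z₁ z₂,
      suNum n τ κ lam f g z₁ z₂ = theta1 τ (z₁ - z₂ - (lam + κ) / n) *
        ∑ k, ∑ l, M k l * (psi n τ k z₁ * psi n τ l z₂) := by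
  have hn' : (n : ℂ) ≠ 0 := by exact_mod_cast hn.ne'
  have hθ := differentiable_theta1 hτ
  have h1 : ∀ z₂, ∃ b : Fin n → ℂ, ∀ z₁, suNum n τ κ lam f g z₁ z₂ =
      theta1 τ (z₁ - z₂ - (lam + κ) / n) * ∑ k, b k * psi n τ k z₁ := fun z₂ => by
    obtain ⟨b, hb⟩ := hf.exists_quotient hn hτ hg (d := z₂ + (lam + κ) / n) (μ := lam) (ν := κ)
      (A := theta1 τ κ * f (z₂ + lam / n)) (B := theta1 τ lam * g (z₂ + κ / n)) (by
        rw [show z₂ + (lam + κ) / n - lam / n = z₂ + κ / n by ring,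
          show z₂ + (lam + κ) / n - κ / n = z₂ + lam / n by ring]
        ring)
    refine ⟨b, fun z₁ => ?_⟩
    rw [sub_sub, ← hb, suNum, ← sub_sub]
    ring
  have h2 : ∀ z₁, ∃ b : Fin n → ℂ, ∀ z₂, suNum n τ κ lam f g z₁ z₂ =
      theta1 τ (z₁ - z₂ - (lam + κ) / n) * ∑ l, b l * psi n τ l z₂ := fun z₁ => by
    obtain ⟨b, hb⟩ := hg.exists_quotient hn hτ hf (d := z₁ - (lam + κ) / n) (μ := -lam) (ν := -κ)
      (A := theta1 τ κ * g (z₁ - lam / n)) (B := theta1 τ lam * f (z₁ - κ / n)) (by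
        rw [show z₁ - (lam + κ) / n - -lam / n = z₁ - κ / n by ring,
          show z₁ - (lam + κ) / n - -κ / n = z₁ - lam / n by ring, theta1_neg, theta1_neg]
        ring)
    refine ⟨b, fun z₂ => ?_⟩
    have hb2 := hb z₂
    rw [show z₂ - (z₁ - (lam + κ) / n) = -(z₁ - z₂ - (lam + κ) / n) by ring, ← neg_add, ← neg_add,
      theta1_neg, theta1_neg, theta1_neg, neg_div, neg_div, sub_neg_eq_add, sub_neg_eq_add] at hb2
    rw [suNum]
    linear_combination -hb2
  choose b hb using h1
  choose d hd using h2
  choose w hw using exists_psi_ne_zero hn hτ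
  refine ⟨fun k l => dft n k (fun z => d z l) (w k) / psi n τ k (w k), fun z₁ => ?_⟩
  -- for `z₂` off the zero set of this entire function, none of the sample points
  -- `w k + s / n` of the discrete Fourier transform in `z₁` is a pole of the operator
  obtain ⟨v, hv⟩ := exists_prod_ne_zero (Finset.univ : Finset (Fin n × Fin n))
    (f := fun p z => theta1 τ (w p.1 + (p.2 : ℕ) / n - z - (lam + κ) / n)) (fun p => by fun_prop)
    (fun p => by
      obtain ⟨u, hu⟩ := exists_theta1_ne_zero hτ
      refine ⟨w p.1 + (p.2 : ℕ) / n - u - (lam + κ) / n, ?_⟩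
      convert hu using 2
      ring)
  have hψ : ∀ k, Differentiable ℂ (psi n τ k) := fun k => (isThetaFn_psi hn hτ k).differentiable
  have hfd := hf.differentiable
  have hgd := hg.differentiable
  intro z₂
  refine sub_eq_zero.mp (eq_zero_of_mul_eq_zero_of_ne
    (f := fun z => ∏ p : Fin n × Fin n, theta1 τ (w p.1 + (p.2 : ℕ) / n - z - (lam + κ) / n))
    (g := fun z₂ => suNum n τ κ lam f g z₁ z₂ - theta1 τ (z₁ - z₂ - (lam + κ) / n) *
        ∑ k, ∑ l, dft n k (fun z => d z l) (w k) / psi n τ k (w k) *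
          (psi n τ k z₁ * psi n τ l z₂)) ?_ ?_ (fun z => ?_) hv z₂)
  · exact Differentiable.fun_finsetProd fun p _ => by fun_prop
  · unfold suNum
    fun_prop
  · rcases eq_or_ne (∏ p : Fin n × Fin n, theta1 τ (w p.1 + (p.2 : ℕ) / n - z - (lam + κ) / n)) 0
      with h0 | h0
    · rw [h0, zero_mul]
    · rw [mul_eq_zero]
      right
      rw [Finset.prod_ne_zero_iff] at h0
      have key : ∀ k, b z k * psi n τ k (w k) =
          ∑ l, dft n k (fun z => d z l) (w k) * psi n τ l z := fun k => by
        rw [← dft_sum_mul]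
        refine ((hasPsiMultipliers_psi hn τ).dft_eq (fun s hs => ?_) k).symm
        refine mul_left_cancel₀ (h0 (k, ⟨s, hs⟩) (Finset.mem_univ _)) ?_
        simp only
        rw [← hb, ← hd]
      rw [hb, ← mul_sub, mul_eq_zero]
      right
      rw [sub_eq_zero]
      refine Finset.sum_congr rfl fun k _ => ?_
      have hbk : b z k = ∑ l, dft n k (fun z => d z l) (w k) / psi n τ k (w k) * psi n τ l z := by
        refine mul_right_cancel₀ (hw k) ?_
        rw [key, Finset.sum_mul]
        refine Finset.sum_congr rfl fun l _ => ?_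
        field_simp [hw k]
      rw [hbk, Finset.sum_mul]
      refine Finset.sum_congr rfl fun l _ => by ring

lemma isBelavin_unique {n : ℕ} (hn : 0 < n) {κ lam : ℂ} {τ : ℍ} {M M' : Mat2 n}
    (h : IsBelavin n κ τ lam M) (h' : IsBelavin n κ τ lam M') : M = M' := by
  have hτ : 0 < (τ : ℂ).im := τ.im_pos
  have hψ : ∀ k, Differentiable ℂ (psi n τ k) := fun k => (isThetaFn_psi hn hτ k).differentiable
  have hθ := differentiable_theta1 hτ
  ext ⟨k, l⟩ ⟨i, j⟩
  refine sub_eq_zero.mp ?_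
  set D : Fin n → Fin n → ℂ := fun k l => M (k, l) (i, j) - M' (k, l) (i, j) with hD
  have h0 : ∀ z₂ z₁, ∑ k, (∑ l, D k l * psi n τ l z₂) * psi n τ k z₁ = 0 := by
    intro z₂ z₁
    set e := z₂ + 2 * (1 / (2 * (n : ℂ)) * lam + κ / (2 * n)) with he
    obtain ⟨w, hw⟩ := exists_theta1_ne_zero hτ
    refine eq_zero_of_mul_eq_zero_of_ne (f := fun z => theta1 τ (z - e))
      (g := fun z₁ => ∑ k, (∑ l, D k l * psi n τ l z₂) * psi n τ k z₁)
      (by fun_prop) (by fun_prop) (fun z => ?_) (w := w + e) (by rwa [add_sub_cancel_right]) z₁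
    rw [mul_eq_zero, or_iff_not_imp_left]
    intro hz
    rw [he, ← sub_sub] at hz
    have h1 := h i j z z₂ hz
    rw [h' i j z z₂ hz] at h1
    rw [← sub_eq_zero.mpr h1.symm, ← Finset.sum_sub_distrib]
    refine Finset.sum_congr rfl fun k _ => ?_
    rw [← Finset.sum_sub_distrib, Finset.sum_mul]
    refine Finset.sum_congr rfl fun l _ => ?_
    rw [hD]
    ring
  exact eq_zero_of_sum_psi hn hτ (fun z₂ => eq_zero_of_sum_psi hn hτ (h0 z₂) k) l

lemma exists_isBelavin {n : ℕ} (hn : 0 < n) {κ lam : ℂ} {τ : ℍ}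
    (hκ : ∀ a b : ℤ, κ ≠ a + b * (τ : ℂ)) (hlam : ∀ a b : ℤ, lam ≠ a + b * (τ : ℂ)) :
    ∃ M : Mat2 n, IsBelavin n κ τ lam M := by
  have hτ : 0 < (τ : ℂ).im := τ.im_pos
  have hθκ : theta1 τ κ ≠ 0 := fun h => by
    obtain ⟨a, b, hab⟩ := (theta1_eq_zero_iff hτ).mp h
    exact hκ a b hab
  have hθlam : theta1 τ lam ≠ 0 := fun h => by
    obtain ⟨a, b, hab⟩ := (theta1_eq_zero_iff hτ).mp h
    exact hlam a b hab
  choose M hM using fun i j : Fin n =>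
    exists_suNum_eq_sum hn hτ κ lam (isThetaFn_psi hn hτ i) (isThetaFn_psi hn hτ j)
  refine ⟨Matrix.of fun kl ij => deriv (theta1 τ) 0 / (theta1 τ κ * theta1 τ lam) *
    M ij.1 ij.2 kl.1 kl.2, fun i j z₁ z₂ hz => ?_⟩
  rw [two_mul_twist_params hn] at hz
  rw [twistedSU_apply hn]
  have h1 := hM i j z₁ z₂
  simp only [Matrix.of_apply, mul_assoc, ← Finset.mul_sum]
  simp only [← mul_assoc] at h1 ⊢
  simp only [mul_assoc _ (psi n τ _ _)] at h1 ⊢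
  rw [div_mul_eq_mul_div, eq_div_iff (mul_ne_zero hθκ hθlam)]
  refine mul_left_cancel₀ hz ?_
  rw [mul_left_comm _ (deriv _ _), ← h1, kernelG, kernelG, suNum]
  field_simp

/-- Away from the lattice, `belavinR` is the matrix of the restricted operator. -/
lemma isBelavin_iff {n : ℕ} (hn : 0 < n) {κ lam : ℂ} {τ : ℍ}
    (hκ : ∀ a b : ℤ, κ ≠ a + b * (τ : ℂ)) (hlam : ∀ a b : ℤ, lam ≠ a + b * (τ : ℂ)) (M : Mat2 n) :
    IsBelavin n κ τ lam M ↔ M = belavinR n κ τ lam := by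
  have hex := exists_isBelavin hn hκ hlam
  have hB : IsBelavin n κ τ lam (belavinR n κ τ lam) := by
    rw [belavinR, dif_pos hex]
    exact hex.choose_spec
  exact ⟨fun h => isBelavin_unique hn h hB, fun h => h ▸ hB⟩

/-! ### Degeneration of theta functions as `Im τ → ∞` -/

lemma tendsto_im_atImInfty : Tendsto (fun τ : ℍ => τ.im) UpperHalfPlane.atImInfty atTop :=
  tendsto_comap

/-- Termwise degeneration of theta series: the `r`-th term decays like
`exp(-π (c r² + 2 b r) Im τ)`, so only the indices with `c r² + 2 b r = 0` survive. -/
lemma tendsto_tsum_jacobiTheta₂_term {b c : ℝ} (hbc : 2 * |b| ≤ c) (w : ℂ) {α : ℤ → ℂ}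
    (hα : Summable fun r : ℤ => ‖α r * jacobiTheta₂_term r (w + b * I) (c * I)‖) :
    Tendsto (fun τ : ℍ => ∑' r : ℤ, α r * jacobiTheta₂_term r (w + b * τ) (c * τ))
      UpperHalfPlane.atImInfty
      (𝓝 (∑' r : ℤ, if c * r ^ 2 + 2 * b * r = 0 then α r * cexp (2 * Real.pi * I * r * w)
        else 0)) := by
  have hnorm : ∀ (r : ℤ) (τ : ℂ), ‖jacobiTheta₂_term r (w + b * τ) (c * τ)‖ =
      Real.exp (-(Real.pi * (c * r ^ 2 + 2 * b * r)) * τ.im - 2 * Real.pi * r * w.im) :=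
    fun r τ => by
      rw [norm_jacobiTheta₂_term]
      congr 1
      simp only [add_im, mul_im, ofReal_re, ofReal_im, zero_mul, add_zero]
      ring
  have hnonneg : ∀ r : ℤ, 0 ≤ c * (r : ℝ) ^ 2 + 2 * b * r := fun r => by
    have h1 : |(r : ℝ)| ≤ (r : ℝ) ^ 2 := by
      rw [← sq_abs]
      rcases eq_or_ne r 0 with rfl | h
      · simp
      · have : (1 : ℝ) ≤ |(r : ℝ)| := by exact_mod_cast Int.one_le_abs h
        nlinarith
    have h2 : -(|b| * |(r : ℝ)|) ≤ b * r := by rw [← abs_mul]; exact neg_abs_le _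
    have h3 : 2 * |b| * |(r : ℝ)| ≤ c * (r : ℝ) ^ 2 :=
      mul_le_mul hbc h1 (abs_nonneg _) (le_trans (by positivity) hbc)
    linarith
  refine tendsto_tsum_of_dominated_convergence hα (fun r => ?_) ?_
  · split_ifs with h
    · refine tendsto_const_nhds.congr fun τ => ?_
      rw [jacobiTheta₂_term]
      congr 2
      have h' : (c : ℂ) * (r : ℂ) ^ 2 + 2 * b * r = 0 := by exact_mod_cast h
      linear_combination -(Real.pi * I * (τ : ℂ)) * h'
    · have hpos : 0 < Real.pi * (c * (r : ℝ) ^ 2 + 2 * b * r) :=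
        mul_pos Real.pi_pos (lt_of_le_of_ne (hnonneg r) (Ne.symm h))
      rw [← mul_zero (α r)]
      refine Tendsto.const_mul _ ?_
      rw [tendsto_zero_iff_norm_tendsto_zero]
      simp only [hnorm]
      refine Real.tendsto_exp_atBot.comp ?_
      refine tendsto_atBot_add_const_right _ _ ?_
      exact tendsto_im_atImInfty.const_mul_atTop_of_neg (neg_lt_zero.mpr hpos)
  · filter_upwards [tendsto_im_atImInfty.eventually_ge_atTop 1] with τ hτ r
    rw [norm_mul, norm_mul, hnorm, hnorm]
    refine mul_le_mul_of_nonneg_left (Real.exp_le_exp.mpr ?_) (norm_nonneg _)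
    have h1 : 0 ≤ Real.pi * (c * (r : ℝ) ^ 2 + 2 * b * r) := mul_nonneg Real.pi_pos.le (hnonneg r)
    have h2 : (τ : ℂ).im = τ.im := rfl
    rw [I_im, h2]
    nlinarith

/-- The function `ψ_a`, scaled to have a limit as `Im τ → ∞`. -/
noncomputable def psiNorm (n : ℕ) (τ : ℂ) (a : Fin n) (z : ℂ) : ℂ :=
  cexp (-(Real.pi * I * (((a : ℕ) : ℂ) - ((n : ℂ) - 1) / 2) ^ 2 * τ / n)) * psi n τ a z

/-- The exponential function that is the limit of the scaled `ψ_a`. -/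
noncomputable def expFn (n : ℕ) (a : Fin n) (z : ℂ) : ℂ :=
  cexp (2 * Real.pi * I * (((a : ℕ) : ℂ) - ((n : ℂ) - 1) / 2) * z)

lemma hasPsiMultipliers_psiNorm {n : ℕ} (hn : 0 < n) (τ : ℂ) :
    HasPsiMultipliers n (psiNorm n τ) := fun a z => by
  rw [psiNorm, psiNorm, psi_add_div hn]
  ring

lemma hasPsiMultipliers_expFn (n : ℕ) : HasPsiMultipliers n (expFn n) := fun a z => by
  rw [expFn, expFn, ← Complex.exp_add]
  congr 1
  ring

lemma tendsto_psiNorm {n : ℕ} (hn : 0 < n) (a : Fin n) (z : ℂ) :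
    Tendsto (fun τ : ℍ => psiNorm n τ a z) UpperHalfPlane.atImInfty (𝓝 (expFn n a z)) := by
  have hn' : (0 : ℝ) < n := by exact_mod_cast hn
  have ha : ((a : ℕ) : ℝ) + 1 ≤ n := by exact_mod_cast a.isLt
  have ha0 : (0 : ℝ) ≤ ((a : ℕ) : ℝ) := by positivity
  have hlim := tendsto_tsum_jacobiTheta₂_term (b := ((a : ℕ) : ℝ) - ((n : ℝ) - 1) / 2) (c := n)
    (by
      rw [← abs_two, ← abs_mul, abs_two]
      exact abs_le.mpr ⟨by linarith, by linarith⟩) (n * z) (α := fun _ => 1) (by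
      simp only [one_mul]
      exact ((summable_jacobiTheta₂_term_iff _ _).mpr (by simpa using hn)).norm)
  rw [tsum_eq_single 0 (fun r hr => ?_)] at hlim
  · have h2 := hlim.const_mul (expFn n a z)
    simp only [Int.cast_zero, mul_zero, zero_mul, ne_eq, OfNat.ofNat_ne_zero, not_false_eq_true,
      zero_pow, add_zero, if_true, Complex.exp_zero, mul_one] at h2
    refine h2.congr fun τ => ?_
    rw [psiNorm, psi_eq_jacobiTheta₂ hn, ← mul_assoc, ← Complex.exp_add, expFn, jacobiTheta₂]
    simp only [one_mul]
    push_cast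
    congr 2
    ring
  -- the exponent `r (n r + 2 a - n + 1)` vanishes only at `r = 0`, as `|2 a - n + 1| < n`
  · rw [if_neg]
    intro h
    have h1 : (r : ℝ) * (n * r + (2 * (a : ℕ) - n + 1)) = 0 := by linear_combination h
    have h2 := (mul_eq_zero.mp h1).resolve_left (by exact_mod_cast hr)
    have h3 : (n : ℝ) ≤ |n * (r : ℝ)| := by
      rw [abs_mul, abs_of_pos hn']
      have : (1 : ℝ) ≤ |(r : ℝ)| := by exact_mod_cast Int.one_le_abs hr
      nlinarith
    have h4 : |n * (r : ℝ)| < n := by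
      rw [eq_neg_of_add_eq_zero_left h2]
      exact abs_lt.mpr ⟨by linarith, by linarith⟩
    linarith

/-- `2 sin (π z)`, the limit of the scaled `ϑ₁`. -/
noncomputable def twoSinPi (z : ℂ) : ℂ := -I * (cexp (Real.pi * I * z) - (cexp (Real.pi * I * z))⁻¹)

/-- In the limit of a theta series with `c = 1` and `b = 1 / 2` two terms survive. -/
lemma tsum_half_eq (φ : ℤ → ℂ) :
    (∑' r : ℤ, if (1 : ℝ) * (r : ℝ) ^ 2 + 2 * (1 / 2 : ℝ) * r = 0 then φ r else 0) =
      φ 0 + φ (-1) := by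
  rw [tsum_eq_sum (s := {0, -1}) fun r hr => ?_]
  · rw [Finset.sum_pair (by norm_num)]
    norm_num
  · rw [if_neg]
    intro h
    have h1 : (r : ℝ) * (r + 1) = 0 := by linear_combination h
    have h2 : r * (r + 1) = 0 := by exact_mod_cast h1
    simp only [Finset.mem_insert, Finset.mem_singleton, not_or] at hr
    rcases mul_eq_zero.mp h2 with h3 | h3 <;> omega

lemma exp_pi_mul_I_half : cexp (Real.pi * I / 2) = I := by
  rw [mul_div_right_comm, Complex.exp_pi_div_two_mul_I]

lemma tendsto_theta1 (z : ℂ) :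
    Tendsto (fun τ : ℍ => cexp (-(Real.pi * I * τ / 4)) * theta1 τ z) UpperHalfPlane.atImInfty
      (𝓝 (twoSinPi z)) := by
  have hlim := tendsto_tsum_jacobiTheta₂_term (b := 1 / 2) (c := 1) (by norm_num [abs_of_pos])
    (z + 1 / 2) (α := fun _ => 1) (by
      simp only [one_mul]
      exact ((summable_jacobiTheta₂_term_iff _ _).mpr (by simp)).norm)
  rw [tsum_half_eq] at hlim
  have h2 := hlim.const_mul (-(cexp (Real.pi * I * (z + 1 / 2))))
  convert! h2 using 2
  · rename_i τ
    rw [theta1_eq_jacobiTheta₂, jacobiTheta₂, mul_neg, ← mul_assoc, ← Complex.exp_add]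
    simp only [one_mul]
    push_cast
    rw [neg_mul]
    congr 3
    · ring
    · funext r
      congr 1 <;> ring
  · have h3 : cexp (Real.pi * I * (z + 1 / 2)) = I * cexp (Real.pi * I * z) := by
      rw [← exp_pi_mul_I_half, ← Complex.exp_add, exp_pi_mul_I_half]
      congr 1
      ring
    have h4 : cexp (2 * Real.pi * I * ((-1 : ℤ) : ℂ) * (z + 1 / 2)) =
        ((I * cexp (Real.pi * I * z)) ^ 2)⁻¹ := by
      rw [← h3, ← Complex.exp_nat_mul, ← Complex.exp_neg]
      congr 1
      push_cast
      ring
    have h5 := Complex.exp_ne_zero (Real.pi * I * z)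
    rw [h4, h3, twoSinPi, mul_pow, I_sq]
    simp only [Int.cast_zero, mul_zero, zero_mul, Complex.exp_zero]
    field_simp
    ring

lemma tendsto_deriv_theta1 :
    Tendsto (fun τ : ℍ => cexp (-(Real.pi * I * τ / 4)) * deriv (theta1 τ) 0)
      UpperHalfPlane.atImInfty (𝓝 (2 * Real.pi)) := by
  have hderiv : ∀ τ : ℍ, deriv (theta1 τ) 0 =
      -(cexp (Real.pi * I * τ / 4 + Real.pi * I / 2) * jacobiTheta₂' (1 / 2 + τ / 2) τ) := by
    intro τ
    have hτ : 0 < (τ : ℂ).im := τ.im_pos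
    have h0 : jacobiTheta₂ (0 + 1 / 2 + τ / 2) τ = 0 := by
      have := theta1_zero hτ
      rw [theta1_eq_jacobiTheta₂, neg_eq_zero] at this
      exact (mul_eq_zero.mp this).resolve_left (Complex.exp_ne_zero _)
    have h1 : HasDerivAt (fun z : ℂ => jacobiTheta₂ (z + 1 / 2 + τ / 2) τ)
        (jacobiTheta₂' (0 + 1 / 2 + τ / 2) τ) 0 := by
      have := hasDerivAt_jacobiTheta₂_fst ((0 : ℂ) + (1 / 2 + τ / 2)) hτ
      have := this.comp_add_const 0 (1 / 2 + (τ : ℂ) / 2)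
      simpa only [add_assoc] using this
    have h2 : DifferentiableAt ℂ
        (fun z : ℂ => cexp (Real.pi * I * τ / 4 + Real.pi * I * (z + 1 / 2))) 0 := by fun_prop
    rw [funext (theta1_eq_jacobiTheta₂ τ), (h2.hasDerivAt.fun_mul h1).fun_neg.deriv, h0, mul_zero,
      zero_add]
    congr 3
    · ring
    · ring
  have hlim := tendsto_tsum_jacobiTheta₂_term (b := 1 / 2) (c := 1) (by norm_num [abs_of_pos])
    (1 / 2) (α := fun r => 2 * Real.pi * I * r)
      ((summable_jacobiTheta₂'_term_iff _ _).mpr (by simp)).norm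
  rw [tsum_half_eq] at hlim
  have h2 := hlim.const_mul (-I)
  convert! h2 using 2
  · rename_i τ
    have : cexp (Real.pi * I * τ / 4 + Real.pi * I / 2) = cexp (Real.pi * I * τ / 4) * I := by
      rw [Complex.exp_add, exp_pi_mul_I_half]
    rw [hderiv, jacobiTheta₂', this, Complex.exp_neg]
    have h5 := Complex.exp_ne_zero (Real.pi * I * τ / 4)
    have h6 : ∀ r : ℤ, jacobiTheta₂'_term r (1 / 2 + τ / 2) τ = 2 * Real.pi * I * r *
        jacobiTheta₂_term r (1 / 2 + ((1 / 2 : ℝ) : ℂ) * τ) (((1 : ℝ) : ℂ) * τ) := fun r => by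
      rw [jacobiTheta₂'_term]
      push_cast
      rw [one_mul, one_div_mul_eq_div]
    simp only [h6]
    field_simp
  · have : cexp (2 * Real.pi * I * ((-1 : ℤ) : ℂ) * (1 / 2)) = -1 := by
      rw [← Complex.exp_neg_pi_mul_I]
      congr 1
      push_cast
      ring
    rw [this]
    push_cast
    linear_combination (2 * Real.pi) * I_sq

/-- The limit of the kernel `G_θ` for `θ = ϑ₁`. -/
noncomputable def trigKernel (z μ : ℂ) : ℂ := 2 * Real.pi * I *
  (1 / (cexp (2 * Real.pi * I * z) - 1) + cexp (Real.pi * I * μ) / hat (cexp (Real.pi * I * μ)))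

lemma hat_exp_ne_zero {μ : ℂ} (h : cexp (2 * Real.pi * I * μ) ≠ 1) :
    hat (cexp (Real.pi * I * μ)) ≠ 0 := by
  intro h0
  have h5 := Complex.exp_ne_zero (Real.pi * I * μ)
  apply h
  rw [show 2 * Real.pi * I * μ = Real.pi * I * μ + Real.pi * I * μ by ring, Complex.exp_add]
  rw [hat] at h0
  field_simp at h0
  linear_combination h0

lemma tendsto_kernelG {z μ : ℂ} (hz : cexp (2 * Real.pi * I * z) ≠ 1)
    (hμ : cexp (2 * Real.pi * I * μ) ≠ 1) :
    Tendsto (fun τ : ℍ => kernelG (theta1 τ) z μ) UpperHalfPlane.atImInfty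
      (𝓝 (trigKernel z μ)) := by
  have hz' := hat_exp_ne_zero hz
  have hμ' := hat_exp_ne_zero hμ
  have hs : ∀ w, twoSinPi w = -I * hat (cexp (Real.pi * I * w)) := fun w => rfl
  have hlim := (tendsto_deriv_theta1.mul (tendsto_theta1 (z + μ))).div
    ((tendsto_theta1 z).mul (tendsto_theta1 μ)) (by
      rw [hs, hs]
      simp [hz', hμ'])
  convert! hlim using 2
  · rename_i τ
    have := Complex.exp_ne_zero (-(Real.pi * I * τ / 4))
    simp only [Pi.div_apply, kernelG]
    rw [mul_mul_mul_comm, mul_mul_mul_comm _ (theta1 _ _),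
      mul_div_mul_left _ _ (mul_ne_zero this this)]
  · have h5 := Complex.exp_ne_zero (Real.pi * I * z)
    have h6 := Complex.exp_ne_zero (Real.pi * I * μ)
    have hzz : cexp (2 * Real.pi * I * z) = cexp (Real.pi * I * z) ^ 2 := by
      rw [← Complex.exp_nat_mul]
      congr 1
      push_cast
      ring
    rw [hzz] at hz
    have hz1 : cexp (Real.pi * I * z) ^ 2 - 1 ≠ 0 := sub_ne_zero.mpr hz
    rw [trigKernel, hs, hs, hs, hzz, mul_add (Real.pi * I : ℂ), Complex.exp_add]
    set X := cexp (Real.pi * I * z)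
    set Y := cexp (Real.pi * I * μ)
    have hX : hat X = (X ^ 2 - 1) / X := by rw [hat]; field_simp
    have hY : hat Y = (Y ^ 2 - 1) / Y := by rw [hat]; field_simp
    have hXY : hat (X * Y) = (X ^ 2 * Y ^ 2 - 1) / (X * Y) := by rw [hat]; field_simp
    have hY1 : Y ^ 2 - 1 ≠ 0 := fun h => hμ' (by rw [hY, h, zero_div])
    rw [hX, hY, hXY]
    field_simp
    rw [I_sq]
    ring

/-! ### The trigonometric Shibukawa–Ueno operator and the Cremmer–Gervais matrix -/

/-- The Shibukawa–Ueno operator with kernel `K`, twisted with parameters `1 / 2n` and `κ / 2n`,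
applied to `f(z₁) g(z₂)`. -/
noncomputable def kernelOp (K : ℂ → ℂ → ℂ) (n : ℕ) (κ lam : ℂ) (f g : ℂ → ℂ) (z₁ z₂ : ℂ) : ℂ :=
  K (z₁ - z₂ - (lam + κ) / n) lam * (f (z₂ + lam / n) * g (z₁ - lam / n)) -
    K (z₁ - z₂ - (lam + κ) / n) κ * (f (z₁ - κ / n) * g (z₂ + κ / n))

lemma twistB_inv (n : ℕ) (μ : ℂ) : (twistB n μ)⁻¹ = twistB n (-μ) := by
  refine Matrix.inv_eq_right_inv ?_
  rw [twistB, twistB, Matrix.diagonal_mul_diagonal, ← Matrix.diagonal_one]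
  congr 1
  funext k
  rw [← Complex.exp_add, ← Complex.exp_zero]
  congr 1
  ring

lemma twistedCG_apply {n : ℕ} (κ lam : ℂ) (k l i j : Fin n) :
    twistedCG n κ (1 / (2 * n)) 0 lam (k, l) (i, j) =
      cexp (Real.pi * I * lam / n * (((i : ℕ) : ℂ) - (j : ℕ) - (k : ℕ) + (l : ℕ))) *
        affCG n κ lam (k, l) (i, j) := by
  rw [twistedCG, twistF, twistF, twistB_inv, twistB_inv, twistB, twistB, twistB, twistB,
    Matrix.diagonal_kronecker_diagonal, Matrix.diagonal_kronecker_diagonal,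
    Matrix.mul_diagonal, Matrix.diagonal_mul]
  simp only
  rw [mul_right_comm, ← Complex.exp_add, ← Complex.exp_add, ← Complex.exp_add]
  congr 2
  ring

/-- The coefficients of the action of the trigonometric operator on monomials, without the phase
and the factor `2 π i`. -/
noncomputable def trigCoef (κ lam : ℂ) (i j k : ℕ) : ℂ :=
  (if i ≤ k ∧ k < j then 1 else 0) - (if j ≤ k ∧ k < i then 1 else 0)
    + (if k = j then cexp (Real.pi * I * lam) / hat (cexp (Real.pi * I * lam)) else 0)
    - (if k = i then cexp (Real.pi * I * κ) / hat (cexp (Real.pi * I * κ)) else 0)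

/-- The case distinction in the Cremmer–Gervais matrix on the diagonal `i + j = k + l`, as a sum of
indicator functions. The identity `q⁻¹ = q - hat q` merges the two cases with `i = k`. -/
lemma constCG_cases {q : ℂ} (hq' : hat q ≠ 0) {i j k : ℕ} :
    (if i = k ∧ j ≤ i then q else if i = k ∧ i < j then q⁻¹ else
      if i < k ∧ k < j then -hat q else if j ≤ k ∧ k < i then hat q else 0) =
    hat q * ((if j ≤ k ∧ k < i then 1 else 0) - (if i ≤ k ∧ k < j then 1 else 0) +
      if k = i then q / hat q else 0) := by
  have h1 : hat q * (-1 + q / hat q) = q⁻¹ := by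
    rw [mul_add, mul_div_cancel₀ _ hq', hat]; ring
  rcases lt_trichotomy i k with h | rfl | h
  · rw [if_neg (by omega), if_neg (by omega)]
    by_cases hk : k < j
    · rw [if_pos ⟨h, hk⟩, if_neg (by omega), if_pos ⟨h.le, hk⟩, if_neg (by omega)]
      ring
    · rw [if_neg (by omega), if_neg (by omega), if_neg (by omega), if_neg (by omega),
        if_neg (by omega)]
      ring
  · by_cases hk : i < j
    · rw [if_neg (by omega), if_pos ⟨rfl, hk⟩, if_neg (by omega), if_pos ⟨le_rfl, hk⟩, if_pos rfl,
        ← h1]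
      ring
    · rw [if_pos ⟨rfl, by omega⟩, if_neg (by omega), if_neg (by omega), if_pos rfl, sub_zero,
        zero_add, mul_div_cancel₀ _ hq']
  · rw [if_neg (by omega), if_neg (by omega), if_neg (by omega)]
    by_cases hk : j ≤ k
    · rw [if_pos ⟨hk, h⟩, if_pos ⟨hk, h⟩, if_neg (by omega), if_neg (by omega)]
      ring
    · rw [if_neg (by omega), if_neg (by omega), if_neg (by omega), if_neg (by omega)]
      ring

lemma smul_twistedCG_apply {n : ℕ} {κ lam : ℂ} (hκ : cexp (2 * Real.pi * I * κ) ≠ 1)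
    (hlam : cexp (2 * Real.pi * I * lam) ≠ 1) (k l i j : Fin n) :
    ((2 * Real.pi * I / (hat (cexp (Real.pi * I * κ)) * hat (cexp (Real.pi * I * lam)))) •
        twistedCG n κ (1 / (2 * n)) 0 lam) (k, l) (i, j) =
      if (i : ℕ) + j = k + l then 2 * Real.pi * I * trigCoef κ lam i j k *
        cexp (2 * Real.pi * I * (lam * (((i : ℕ) : ℂ) - (k : ℕ)) +
          κ * (((j : ℕ) : ℂ) - (k : ℕ))) / n) else 0 := by
  have hκ' := hat_exp_ne_zero hκ
  have hlam' := hat_exp_ne_zero hlam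
  rw [Matrix.smul_apply, twistedCG_apply, affCG, Matrix.sub_apply, Matrix.smul_apply,
    Matrix.smul_apply, permP, constCG, Matrix.of_apply, Matrix.of_apply]
  simp only [smul_eq_mul, Fin.ext_iff, Fin.le_def, Fin.lt_def]
  by_cases h : (i : ℕ) + j = k + l
  · have hn : (n : ℂ) ≠ 0 := by
      have := i.pos
      exact_mod_cast this.ne'
    have e1 : ((i : ℕ) = k ∧ (j : ℕ) = l ∧ (j : ℕ) ≤ i) ↔ ((i : ℕ) = k ∧ (j : ℕ) ≤ i) := by omega
    have e2 : ((i : ℕ) = k ∧ (j : ℕ) = l ∧ (i : ℕ) < j) ↔ ((i : ℕ) = k ∧ (i : ℕ) < j) := by omega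
    have e3 : ((k : ℕ) = j ∧ (l : ℕ) = i) ↔ (k : ℕ) = j := by omega
    simp only [e1, e2, e3, h, and_true, if_true]
    rw [constCG_cases hκ', ← Complex.exp_int_mul, trigCoef]
    have hl : (l : ℕ) = ((i : ℕ) : ℂ) + (j : ℕ) - (k : ℕ) := by
      rw [eq_sub_iff_add_eq']
      exact_mod_cast h.symm
    have hphase : cexp (2 * Real.pi * I * (lam * (((i : ℕ) : ℂ) - (k : ℕ)) +
        κ * (((j : ℕ) : ℂ) - (k : ℕ))) / n) =
        cexp (Real.pi * I * lam / n * (((i : ℕ) : ℂ) - (j : ℕ) - (k : ℕ) + (l : ℕ))) *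
        cexp (((2 * (((j : ℕ) : ℤ) - ((k : ℕ) : ℤ)) : ℤ) : ℂ) * (Real.pi * I * κ / n)) := by
      rw [← Complex.exp_add, hl]
      congr 1
      push_cast
      field_simp
      ring
    -- the `p`-power is trivial on the support of the permutation
    have hP : (if (k : ℕ) = j then (1 : ℂ) else 0) = (if (k : ℕ) = j then 1 else 0) *
        cexp (((2 * (((j : ℕ) : ℤ) - ((k : ℕ) : ℤ)) : ℤ) : ℂ) * (Real.pi * I * κ / n)) := by
      split_ifs with hk
      · simp [hk]
      · simp
    have hη : (if (k : ℕ) = j then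
          cexp (Real.pi * I * lam) / hat (cexp (Real.pi * I * lam)) else 0) =
        (if (k : ℕ) = j then 1 else 0) *
          (cexp (Real.pi * I * lam) / hat (cexp (Real.pi * I * lam))) := by
      rw [ite_mul, one_mul, zero_mul]
    rw [hη, hphase]
    generalize cexp (((2 * (((j : ℕ) : ℤ) - ((k : ℕ) : ℤ)) : ℤ) : ℂ) * (Real.pi * I * κ / n)) = p
      at hP ⊢
    generalize (if (k : ℕ) = j then (1 : ℂ) else 0) = δ at hP ⊢
    field_simp
    linear_combination cexp (Real.pi * I * lam) * hP
  · rw [if_neg h, if_neg (by omega), if_neg (by omega), if_neg (by omega), if_neg (by omega),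
      if_neg (by omega)]
    ring

lemma sum_trigCoef_mul_pow {n : ℕ} {κ lam x : ℂ} (hx : x ≠ 1) (i j : Fin n) :
    ∑ k : Fin n, trigCoef κ lam i j k * x ^ (k : ℕ) = (x ^ (j : ℕ) - x ^ (i : ℕ)) / (x - 1) +
      cexp (Real.pi * I * lam) / hat (cexp (Real.pi * I * lam)) * x ^ (j : ℕ) -
      cexp (Real.pi * I * κ) / hat (cexp (Real.pi * I * κ)) * x ^ (i : ℕ) := by
  have hgeom : ∀ i j : ℕ, j < n → ∑ k ∈ Finset.range n, (if i ≤ k ∧ k < j then 1 else 0) * x ^ k =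
      if i ≤ j then (x ^ j - x ^ i) / (x - 1) else 0 := fun i j hj => by
    simp only [ite_mul, one_mul, zero_mul]
    rw [← Finset.sum_filter]
    have : (Finset.range n).filter (fun k => i ≤ k ∧ k < j) = Finset.Ico i j := by
      ext k
      simp only [Finset.mem_filter, Finset.mem_range, Finset.mem_Ico]
      omega
    rw [this]
    split_ifs with h
    · exact geom_sum_Ico hx h
    · rw [Finset.Ico_eq_empty (by omega), Finset.sum_empty]
  rw [Fin.sum_univ_eq_sum_range (fun k => trigCoef κ lam i j k * x ^ k) n]
  simp only [trigCoef, sub_mul, add_mul, Finset.sum_add_distrib, Finset.sum_sub_distrib]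
  rw [hgeom _ _ j.isLt, hgeom _ _ i.isLt]
  have h1 : ∀ (c : ℂ) (i : Fin n), ∑ k ∈ Finset.range n, (if k = (i : ℕ) then c else 0) * x ^ k =
      c * x ^ (i : ℕ) := fun c i => by
    simp [ite_mul]
  rw [h1, h1]
  congr 2
  rcases lt_trichotomy (i : ℕ) j with h | h | h
  · rw [if_pos h.le, if_neg (by omega), sub_zero]
  · rw [h]; simp
  · rw [if_neg (by omega), if_pos h.le]
    ring

/-- The trigonometric operator acts on exponential functions through the Cremmer–Gervais matrix. -/
lemma kernelOp_trigKernel {n : ℕ} {κ lam z₁ z₂ : ℂ} (hκ : cexp (2 * Real.pi * I * κ) ≠ 1)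
    (hlam : cexp (2 * Real.pi * I * lam) ≠ 1)
    (hz : cexp (2 * Real.pi * I * (z₁ - z₂ - (lam + κ) / n)) ≠ 1) (i j : Fin n) :
    kernelOp trigKernel n κ lam (expFn n i) (expFn n j) z₁ z₂ =
      ∑ k, ∑ l, ((2 * Real.pi * I /
        (hat (cexp (Real.pi * I * κ)) * hat (cexp (Real.pi * I * lam)))) •
        twistedCG n κ (1 / (2 * n)) 0 lam) (k, l) (i, j) * (expFn n k z₁ * expFn n l z₂) := by
  have hn : (n : ℂ) ≠ 0 := by
    have := i.pos
    exact_mod_cast this.ne'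
  simp only [smul_twistedCG_apply hκ hlam]
  set c := ((n : ℂ) - 1) / 2 with hc
  set u := z₁ - z₂ - (lam + κ) / n with hu
  set x := cexp (2 * Real.pi * I * u) with hx
  -- the common exponential factor of all terms
  set E := cexp (2 * Real.pi * I * ((((i : ℕ) : ℂ) - c) * (z₂ + lam / n) +
    (((j : ℕ) : ℂ) - c) * (z₂ + κ / n) - c * u)) with hE
  have hinner : ∀ k : Fin n, ∑ l : Fin n, (if (i : ℕ) + j = k + l then
      2 * Real.pi * I * trigCoef κ lam i j k *
        cexp (2 * Real.pi * I * (lam * (((i : ℕ) : ℂ) - (k : ℕ)) +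
          κ * (((j : ℕ) : ℂ) - (k : ℕ))) / n) else 0) * (expFn n k z₁ * expFn n l z₂) =
      2 * Real.pi * I * E * (trigCoef κ lam i j k * x ^ (k : ℕ)) := fun k => by
    have hki := i.isLt
    have hkj := j.isLt
    by_cases hr : (k : ℕ) ≤ i + j ∧ i + j - k < n
    · obtain ⟨hr1, hr2⟩ := hr
      rw [Finset.sum_eq_single ⟨(i : ℕ) + j - k, hr2⟩]
      · rw [if_pos (by simp only; omega)]
        have key : cexp (2 * Real.pi * I * (lam * (((i : ℕ) : ℂ) - (k : ℕ)) +
          κ * (((j : ℕ) : ℂ) - (k : ℕ))) / n) *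
            (expFn n k z₁ * expFn n ⟨(i : ℕ) + j - k, hr2⟩ z₂) = E * x ^ (k : ℕ) := by
          rw [expFn, expFn, hE, hx, ← Complex.exp_nat_mul, ← Complex.exp_add, ← Complex.exp_add,
            ← Complex.exp_add]
          congr 1
          simp only
          rw [Nat.cast_sub hr1, hu]
          push_cast
          field_simp
          ring
        linear_combination 2 * Real.pi * I * trigCoef κ lam i j k * key
      · intro l _ hl
        rw [if_neg (fun h => hl (Fin.ext (by simp only; omega))), zero_mul]
      · simp
    · have h0 : trigCoef κ lam i j k = 0 := by
        rw [trigCoef, if_neg (by omega), if_neg (by omega), if_neg (by omega), if_neg (by omega)]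
        ring
      simp [h0]
  rw [Finset.sum_congr rfl fun k _ => hinner k, ← Finset.mul_sum, sum_trigCoef_mul_pow hz]
  have h1 : expFn n i (z₂ + lam / n) * expFn n j (z₁ - lam / n) = E * x ^ (j : ℕ) := by
    rw [expFn, expFn, hE, hx, ← Complex.exp_nat_mul, ← Complex.exp_add, ← Complex.exp_add]
    congr 1
    rw [hu]
    field_simp
    ring
  have h2 : expFn n i (z₁ - κ / n) * expFn n j (z₂ + κ / n) = E * x ^ (i : ℕ) := by
    rw [expFn, expFn, hE, hx, ← Complex.exp_nat_mul, ← Complex.exp_add, ← Complex.exp_add]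
    congr 1
    rw [hu]
    field_simp
    ring
  rw [kernelOp, h1, h2, trigKernel, trigKernel, ← hx]
  ring

/-! ### The limit of Belavin's `R`-matrix -/

/-- The matrix of an operator on functions of two variables is recovered from its values at finitely
many points. -/
lemma HasPsiMultipliers.dft_dft_eq {n : ℕ} {φ : Fin n → ℂ → ℂ} (hφ : HasPsiMultipliers n φ)
    {F : ℂ → ℂ → ℂ} {M : Fin n → Fin n → ℂ} {w v : ℂ}
    (hF : ∀ s < n, ∀ t < n, F (w + s / n) (v + t / n) =
      ∑ k, ∑ l, M k l * (φ k (w + s / n) * φ l (v + t / n))) (k l : Fin n) :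
    dft n k (fun z => dft n l (F z) v) w = M k l * (φ k w * φ l v) := by
  rw [hφ.dft_eq (b := fun k => M k l * φ l v) (fun s hs => ?_) k]
  · ring
  · rw [hφ.dft_eq (b := fun l => ∑ k, M k l * φ k (w + s / n)) (fun t ht => ?_) l, Finset.sum_mul]
    · refine Finset.sum_congr rfl fun k _ => by ring
    · rw [hF s hs t ht, Finset.sum_comm]
      refine Finset.sum_congr rfl fun l _ => ?_
      rw [Finset.sum_mul]
      refine Finset.sum_congr rfl fun k _ => by ring

lemma tendsto_dft {ι : Type*} {L : Filter ι} {n : ℕ} {k : Fin n} {H : ι → ℂ → ℂ} {H₀ : ℂ → ℂ}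
    {z : ℂ} (h : ∀ s < n, Tendsto (fun x => H x (z + s / n)) L (𝓝 (H₀ (z + s / n)))) :
    Tendsto (fun x => dft n k (H x) z) L (𝓝 (dft n k H₀ z)) :=
  (tendsto_finsetSum _ fun s hs => (h s (Finset.mem_range.mp hs)).const_mul _).div_const _

lemma exp_ne_one_of_ne_int {μ : ℂ} (h : ∀ a : ℤ, μ ≠ a) : cexp (2 * Real.pi * I * μ) ≠ 1 := by
  intro h1
  obtain ⟨a, ha⟩ := Complex.exp_eq_one_iff.mp h1
  exact h a (mul_left_cancel₀ Complex.two_pi_I_ne_zero (by rw [ha]; ring))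

/-- A complex number that is not an integer lies outside the lattice `ℤ + ℤ τ` if `Im τ` is
large. -/
lemma eventually_not_mem_lattice {μ : ℂ} (h : ∀ a : ℤ, μ ≠ a) :
    ∀ᶠ τ : ℍ in UpperHalfPlane.atImInfty, ∀ a b : ℤ, μ ≠ a + b * (τ : ℂ) := by
  filter_upwards [tendsto_im_atImInfty.eventually_gt_atTop |μ.im|] with τ hτ a b hab
  have him := congrArg Complex.im hab
  have h2 : (τ : ℂ).im = τ.im := rfl
  simp only [add_im, intCast_im, mul_im, intCast_re, zero_mul, add_zero, zero_add, h2] at him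
  rcases eq_or_ne b 0 with rfl | hb
  · exact h a (by simpa using hab)
  · have h1 : (1 : ℝ) ≤ |(b : ℝ)| := by exact_mod_cast Int.one_le_abs hb
    rw [him, abs_mul, abs_of_pos τ.im_pos] at hτ
    nlinarith [τ.im_pos]

lemma gauge_conj_apply (n : ℕ) (τ : ℂ) (R : Mat2 n) (k l i j : Fin n) :
    ((gaugeG n τ ⊗ₖ gaugeG n τ)⁻¹ * R * (gaugeG n τ ⊗ₖ gaugeG n τ)) (k, l) (i, j) =
      (cexp (-(Real.pi * I * (((k : ℕ) : ℂ) - ((n : ℂ) - 1) / 2) ^ 2 * τ / n)) *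
        cexp (-(Real.pi * I * (((l : ℕ) : ℂ) - ((n : ℂ) - 1) / 2) ^ 2 * τ / n)))⁻¹ *
      R (k, l) (i, j) *
      (cexp (-(Real.pi * I * (((i : ℕ) : ℂ) - ((n : ℂ) - 1) / 2) ^ 2 * τ / n)) *
        cexp (-(Real.pi * I * (((j : ℕ) : ℂ) - ((n : ℂ) - 1) / 2) ^ 2 * τ / n))) := by
  have hinv : (gaugeG n τ ⊗ₖ gaugeG n τ)⁻¹ = Matrix.diagonal fun p : Fin n × Fin n =>
      (cexp (-(Real.pi * I * (((p.1 : ℕ) : ℂ) - ((n : ℂ) - 1) / 2) ^ 2 * τ / n)) *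
        cexp (-(Real.pi * I * (((p.2 : ℕ) : ℂ) - ((n : ℂ) - 1) / 2) ^ 2 * τ / n)))⁻¹ := by
    refine Matrix.inv_eq_right_inv ?_
    rw [gaugeG, Matrix.diagonal_kronecker_diagonal, Matrix.diagonal_mul_diagonal,
      ← Matrix.diagonal_one]
    congr 1
    funext p
    exact mul_inv_cancel₀ (mul_ne_zero (Complex.exp_ne_zero _) (Complex.exp_ne_zero _))
  rw [hinv, gaugeG, Matrix.diagonal_kronecker_diagonal, Matrix.mul_diagonal, Matrix.diagonal_mul]

/-- After conjugation by the gauge matrix, Belavin's `R`-matrix describes the operator in the basis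
of the scaled functions. -/
lemma kernelOp_psiNorm {n : ℕ} (hn : 0 < n) {κ lam : ℂ} {τ : ℍ} {R : Mat2 n}
    (hR : IsBelavin n κ τ lam R) (i j : Fin n) {z₁ z₂ : ℂ}
    (hz : theta1 τ (z₁ - z₂ - (lam + κ) / n) ≠ 0) :
    kernelOp (kernelG (theta1 τ)) n κ lam (psiNorm n τ i) (psiNorm n τ j) z₁ z₂ =
      ∑ k, ∑ l, ((gaugeG n τ ⊗ₖ gaugeG n τ)⁻¹ * R * (gaugeG n τ ⊗ₖ gaugeG n τ)) (k, l) (i, j) *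
        (psiNorm n τ k z₁ * psiNorm n τ l z₂) := by
  have h1 := hR i j z₁ z₂ (by rwa [two_mul_twist_params hn])
  rw [twistedSU_apply hn] at h1
  have h2 : kernelOp (kernelG (theta1 τ)) n κ lam (psiNorm n τ i) (psiNorm n τ j) z₁ z₂ =
      (cexp (-(Real.pi * I * (((i : ℕ) : ℂ) - ((n : ℂ) - 1) / 2) ^ 2 * τ / n)) *
        cexp (-(Real.pi * I * (((j : ℕ) : ℂ) - ((n : ℂ) - 1) / 2) ^ 2 * τ / n))) *
      ∑ k, ∑ l, R (k, l) (i, j) * (psi n τ k z₁ * psi n τ l z₂) := by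
    rw [← h1]
    simp only [kernelOp, psiNorm]
    ring
  rw [h2, Finset.mul_sum]
  refine Finset.sum_congr rfl fun k _ => ?_
  rw [Finset.mul_sum]
  refine Finset.sum_congr rfl fun l _ => ?_
  rw [gauge_conj_apply, psiNorm, psiNorm]
  have hk := Complex.exp_ne_zero (-(Real.pi * I * (((k : ℕ) : ℂ) - ((n : ℂ) - 1) / 2) ^ 2 * τ / n))
  have hl := Complex.exp_ne_zero (-(Real.pi * I * (((l : ℕ) : ℂ) - ((n : ℂ) - 1) / 2) ^ 2 * τ / n))
  generalize cexp (-(Real.pi * I * (((k : ℕ) : ℂ) - ((n : ℂ) - 1) / 2) ^ 2 * τ / n)) = a at hk ⊢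
  generalize cexp (-(Real.pi * I * (((l : ℕ) : ℂ) - ((n : ℂ) - 1) / 2) ^ 2 * τ / n)) = b at hl ⊢
  rw [mul_inv]
  linear_combination (-(R (k, l) (i, j) * psi n τ k z₁ * psi n τ l z₂ *
    cexp (-(Real.pi * I * (((i : ℕ) : ℂ) - ((n : ℂ) - 1) / 2) ^ 2 * τ / n)) *
    cexp (-(Real.pi * I * (((j : ℕ) : ℂ) - ((n : ℂ) - 1) / 2) ^ 2 * τ / n)))) *
    (b⁻¹ * b * mul_inv_cancel₀ hk + mul_inv_cancel₀ hl)

lemma tendsto_kernelOp {n : ℕ} (hn : 0 < n) {κ lam z₁ z₂ : ℂ}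
    (hκ : cexp (2 * Real.pi * I * κ) ≠ 1) (hlam : cexp (2 * Real.pi * I * lam) ≠ 1)
    (hz : cexp (2 * Real.pi * I * (z₁ - z₂ - (lam + κ) / n)) ≠ 1) (i j : Fin n) :
    Tendsto (fun τ : ℍ =>
        kernelOp (kernelG (theta1 τ)) n κ lam (psiNorm n τ i) (psiNorm n τ j) z₁ z₂)
      UpperHalfPlane.atImInfty
      (𝓝 (kernelOp trigKernel n κ lam (expFn n i) (expFn n j) z₁ z₂)) :=
  ((tendsto_kernelG hz hlam).mul ((tendsto_psiNorm hn _ _).mul (tendsto_psiNorm hn _ _))).sub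
    ((tendsto_kernelG hz hκ).mul ((tendsto_psiNorm hn _ _).mul (tendsto_psiNorm hn _ _)))

lemma I_add_ofReal_ne_int (x : ℝ) (a : ℤ) : I + (x : ℂ) ≠ a := fun h => by
  simpa using congrArg Complex.im h

lemma tendsto_gauge_conj_belavinR {n : ℕ} (hn : 0 < n) {κ lam : ℂ}
    (hκ : ∀ a : ℤ, κ ≠ a) (hlam : ∀ a : ℤ, lam ≠ a) :
    Tendsto
      (fun τ : ℍ => (gaugeG n τ ⊗ₖ gaugeG n τ)⁻¹ * belavinR n κ τ lam *
        (gaugeG n τ ⊗ₖ gaugeG n τ))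
      UpperHalfPlane.atImInfty
      (𝓝 ((2 * Real.pi * I / (hat (cexp (Real.pi * I * κ)) * hat (cexp (Real.pi * I * lam)))) •
        twistedCG n κ (1 / (2 * n)) 0 lam)) := by
  have hκ1 := exp_ne_one_of_ne_int hκ
  have hlam1 := exp_ne_one_of_ne_int hlam
  refine tendsto_pi_nhds.mpr fun kl => tendsto_pi_nhds.mpr fun ij => ?_
  obtain ⟨k, l⟩ := kl
  obtain ⟨i, j⟩ := ij
  -- on the sample points `(w + s / n, t / n)` the argument of the kernel is `I + (s - t) / n`,
  -- which is a pole neither of `trigKernel` nor, once `Im τ > 1`, of the elliptic kernel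
  set w : ℂ := (lam + κ) / n + I with hw
  have hpt : ∀ s t : ℕ, w + s / n - (0 + t / n) - (lam + κ) / n =
      I + (((s - t) / n : ℝ) : ℂ) := fun s t => by
    rw [hw]; push_cast; ring
  have htrig : ∀ s t : ℕ, cexp (2 * Real.pi * I * (w + s / n - (0 + t / n) - (lam + κ) / n)) ≠ 1 :=
    fun s t => by
      rw [hpt]
      exact exp_ne_one_of_ne_int (I_add_ofReal_ne_int _)
  have hexp0 : ∀ (a : Fin n) z, expFn n a z ≠ 0 := fun a z => Complex.exp_ne_zero _
  have hlim : Tendsto (fun τ : ℍ => dft n k (fun z => dft n l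
      (kernelOp (kernelG (theta1 τ)) n κ lam (psiNorm n τ i) (psiNorm n τ j) z) 0) w)
      UpperHalfPlane.atImInfty (𝓝 (dft n k (fun z => dft n l
        (kernelOp trigKernel n κ lam (expFn n i) (expFn n j) z) 0) w)) :=
    tendsto_dft fun s _ => tendsto_dft fun t _ => tendsto_kernelOp hn hκ1 hlam1 (htrig s t) i j
  rw [(hasPsiMultipliers_expFn n).dft_dft_eq
    (M := fun k l => ((2 * Real.pi * I /
      (hat (cexp (Real.pi * I * κ)) * hat (cexp (Real.pi * I * lam)))) •
        twistedCG n κ (1 / (2 * n)) 0 lam) (k, l) (i, j))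
    (fun s _ t _ => kernelOp_trigKernel hκ1 hlam1 (htrig s t) i j)] at hlim
  have hquot := hlim.div ((tendsto_psiNorm hn k w).mul (tendsto_psiNorm hn l 0))
    (mul_ne_zero (hexp0 k w) (hexp0 l 0))
  rw [mul_div_cancel_right₀ _ (mul_ne_zero (hexp0 k w) (hexp0 l 0))] at hquot
  refine hquot.congr' ?_
  filter_upwards [eventually_not_mem_lattice hκ, eventually_not_mem_lattice hlam,
    tendsto_im_atImInfty.eventually_gt_atTop 1,
    (tendsto_psiNorm hn k w).eventually_ne (hexp0 k w),
    (tendsto_psiNorm hn l 0).eventually_ne (hexp0 l 0)] with τ hτκ hτlam hτ1 hk hl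
  have hR := (isBelavin_iff hn hτκ hτlam _).mpr rfl
  have hθ : ∀ s t : ℕ, theta1 τ (w + s / n - (0 + t / n) - (lam + κ) / n) ≠ 0 := fun s t h => by
    rw [hpt] at h
    obtain ⟨a, b, hab⟩ := (theta1_eq_zero_iff τ.im_pos).mp h
    have him := congrArg Complex.im hab
    have h2 : (τ : ℂ).im = τ.im := rfl
    simp only [add_im, I_im, ofReal_im, intCast_im, mul_im, intCast_re, zero_mul, add_zero,
      zero_add, h2] at him
    have hb0 : 0 < (b : ℝ) := pos_of_mul_pos_left (by rw [← him]; exact one_pos) τ.im_pos.le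
    have hb1 : (1 : ℝ) ≤ b := by exact_mod_cast (Int.cast_pos.mp hb0 : 0 < b)
    nlinarith
  simp only [Pi.div_apply]
  rw [(hasPsiMultipliers_psiNorm hn τ).dft_dft_eq
    (M := fun k l => ((gaugeG n τ ⊗ₖ gaugeG n τ)⁻¹ * belavinR n κ τ lam *
      (gaugeG n τ ⊗ₖ gaugeG n τ)) (k, l) (i, j))
    (fun s _ t _ => kernelOp_psiNorm hn hR i j (hθ s t)),
    mul_div_cancel_right₀ _ (mul_ne_zero hk hl)]

end SU

/-- Belavin's `R`-matrix is well defined, and after conjugation by `G ⊗ G` it degenerates to a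
multiple of the twisted affinized Cremmer–Gervais matrix `R_{CG(1/2n,0)}` as `Im τ → ∞`. -/
theorem mainTheorem3 (n : ℕ) (hn : 0 < n) (κ lam : ℂ)
    (hκ : ∀ a : ℤ, κ ≠ a) (hlam : ∀ a : ℤ, lam ≠ a) :
    (∀ τ : ℍ, (∀ a b : ℤ, κ ≠ a + b * (τ : ℂ)) → (∀ a b : ℤ, lam ≠ a + b * (τ : ℂ)) →
      ∀ M : SU.Mat2 n, SU.IsBelavin n κ τ lam M ↔ M = SU.belavinR n κ τ lam) ∧
    Tendsto
      (fun τ : ℍ => (SU.gaugeG n τ ⊗ₖ SU.gaugeG n τ)⁻¹ * SU.belavinR n κ τ lam *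
        (SU.gaugeG n τ ⊗ₖ SU.gaugeG n τ))
      UpperHalfPlane.atImInfty
      (𝓝 ((2 * Real.pi * I /
          (SU.hat (cexp (Real.pi * I * κ)) * SU.hat (cexp (Real.pi * I * lam)))) •
        SU.twistedCG n κ (1 / (2 * n)) 0 lam)) :=
  ⟨fun _ hτκ hτlam M => SU.isBelavin_iff hn hτκ hτlam M,
    SU.tendsto_gauge_conj_belavinR hn hκ hlam⟩
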